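/- \textbf{Theorem.} All homology and cohomology is simplicial with $\mathbb{Z}_2$ coefficients. Let $K$ be a triangulated closed surface, i.e. a finite simplicial complex of dimension at most $2$ in which the link of every vertex is a cycle ($K$ need not be connected). Let $\zeta\in Z_1(K)$ be a $1$-cycle that is not a boundary. A set $S$ of edges of $K$ is a \emph{topological hitting set} for $\zeta$ if every $1$-cycle $\zeta'$ homologous to $\zeta$ contains an edge of $S$; it is \emph{optimal} if it has minimum cardinality among all topological hitting sets for $\zeta$. The \emph{weight} of a $1$-cochain $\eta\in C^1(K)=\mathrm{Hom}(C_1(K),\mathbb{Z}_2)$ is the number of edges $e$ with $\eta(e)=1$. A \emph{cohomology basis} is a family of $1$-cocycles whose classes form a basis of $H^1(K)$; it is \emph{optimal} if the sum of the weights of its members is minimum among all cohomology bases. Consider the following algorithm with input $(K,\zeta)$: (1) compute an optimal cohomology basis of $K$; (2) arrange it in ascending order of weight, $\nu_1,\dots,\nu_g$; (3) return a cocycle $\nu_k$ of smallest weight among those $\nu_j$ with $\nu_j(\zeta)=1$. Then: (a) the algorithm is correct: an optimal cohomology basis exists, some member of it takes the value $1$ at $\zeta$, and, whichever optimal basis,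 ordering by weight and lightest cocycle $\nu_k$ with $\nu_k(\zeta)=1$ are chosen, the edge set $\{e : \nu_k(e)=1\}$ is an optimal topological hitting set for $\zeta$; (b) the algorithm runs in polynomial time: there are one program for a random access machine (with addition, truncated subtraction, indirect addressing and zero tests at unit cost) and one polynomial $p$ such that, for every such $K$ and $\zeta$, given by the number of vertices, a list of the edges, a list of the triangles and the coefficients of $\zeta$, the program halts after at most $p(N)$ steps, where $N$ is the number of simplices of $K$, and outputs an optimal cohomology basis sorted by weight together with a lightest $\nu_k$ in it with $\nu_k(\zeta)=1$; in particular it outputs an optimal topological hitting set for $\zeta$. -/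

import Mathlib

/-! ## Simplicial homology and cohomology with `ℤ/2` coefficients -/

noncomputable section

namespace THS

variable {V : Type*}

/-- The `p`-simplices of an abstract simplicial complex: the faces with `p + 1` vertices. -/
abbrev Simplex (K : AbstractSimplicialComplex V) (p : ℕ) : Type _ :=
  {s : Finset V // s ∈ K ∧ s.card = p + 1}

variable [Finite V]

instance simplexFintype (K : AbstractSimplicialComplex V) (p : ℕ) : Fintype (Simplex K p) :=
  Fintype.ofFinite _

/-- `p`-chains with `ℤ/2` coefficients. -/
abbrev Chain (K : AbstractSimplicialComplex V) (p : ℕ) : Type _ := Simplex K p → ZMod 2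

/-- `p`-cochains: the dual space of the space of `p`-chains. -/
abbrev Cochain (K : AbstractSimplicialComplex V) (p : ℕ) : Type _ :=
  Chain K p →ₗ[ZMod 2] ZMod 2

/-- The `p`-chain that consists of the single simplex `σ`. -/
def single (K : AbstractSimplicialComplex V) {p : ℕ} (σ : Simplex K p) : Chain K p :=
  open Classical in Pi.single σ 1

/-- The boundary map from `(p+1)`-chains to `p`-chains: the coefficient of `∂ c` at a `p`-simplex
`τ` is the sum of the coefficients of `c` at the `(p+1)`-simplices that have `τ` as a face. -/
def boundary (K : AbstractSimplicialComplex V) (p : ℕ) :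
    Chain K (p + 1) →ₗ[ZMod 2] Chain K p where
  toFun c τ := open Classical in ∑ σ : Simplex K (p + 1), if τ.1 ⊆ σ.1 then c σ else 0
  map_add' c d := by
    funext τ
    simp only [Pi.add_apply, ← Finset.sum_add_distrib]
    refine Finset.sum_congr rfl fun σ _ => ?_
    split_ifs <;> simp
  map_smul' a c := by
    funext τ
    simp [Finset.mul_sum]

/-- The coboundary map, adjoint to the boundary map. -/
def coboundary (K : AbstractSimplicialComplex V) (p : ℕ) :
    Cochain K p →ₗ[ZMod 2] Cochain K (p + 1) :=
  (boundary K p).dualMap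

/-- The space of 1-cycles. -/
def Z₁ (K : AbstractSimplicialComplex V) : Submodule (ZMod 2) (Chain K 1) :=
  LinearMap.ker (boundary K 0)

/-- The space of 1-boundaries. -/
def B₁ (K : AbstractSimplicialComplex V) : Submodule (ZMod 2) (Chain K 1) :=
  LinearMap.range (boundary K 1)

/-- The space of 1-cocycles. -/
def coZ₁ (K : AbstractSimplicialComplex V) : Submodule (ZMod 2) (Cochain K 1) :=
  LinearMap.ker (coboundary K 1)

/-- The space of 1-coboundaries. -/
def coB₁ (K : AbstractSimplicialComplex V) : Submodule (ZMod 2) (Cochain K 1) :=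
  LinearMap.range (coboundary K 0)

/-- The first cohomology space: 1-cocycles modulo 1-coboundaries, as a subspace of the space of
1-cochains modulo 1-coboundaries. -/
def coH₁ (K : AbstractSimplicialComplex V) : Submodule (ZMod 2) (Cochain K 1 ⧸ coB₁ K) :=
  (coZ₁ K).map (coB₁ K).mkQ

/-- The class of a 1-cochain modulo 1-coboundaries. -/
def cls (K : AbstractSimplicialComplex V) (η : Cochain K 1) : Cochain K 1 ⧸ coB₁ K :=
  (coB₁ K).mkQ η

/-! ## Cohomology bases -/

/-- The set of edges at which a 1-cochain takes the value 1. -/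
def support (K : AbstractSimplicialComplex V) (η : Cochain K 1) : Finset (Simplex K 1) :=
  open Classical in Finset.univ.filter fun e => η (single K e) = 1

/-- The weight of a 1-cochain, for unit weights on the edges. -/
def weight (K : AbstractSimplicialComplex V) (η : Cochain K 1) : ℕ := (support K η).card

/-- A family of 1-cocycles whose cohomology classes form a basis of the first cohomology. -/
def IsCohomologyBasis (K : AbstractSimplicialComplex V) {g : ℕ} (ν : Fin g → Cochain K 1) : Prop :=
  (∀ j, ν j ∈ coZ₁ K) ∧
    LinearIndependent (ZMod 2) (fun j => cls K (ν j)) ∧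
    Submodule.span (ZMod 2) (Set.range fun j => cls K (ν j)) = coH₁ K

/-- A cohomology basis whose total weight is minimum among all cohomology bases. -/
def IsMinCohomologyBasis (K : AbstractSimplicialComplex V) {g : ℕ} (ν : Fin g → Cochain K 1) : Prop :=
  IsCohomologyBasis K ν ∧
    ∀ (g' : ℕ) (ν' : Fin g' → Cochain K 1), IsCohomologyBasis K ν' →
      ∑ j, weight K (ν j) ≤ ∑ j, weight K (ν' j)

/-- The possible results of the three-step algorithm on input `(K, ζ)`: a minimum weight cohomology
basis `ν`, arranged in ascending order of weight, and the index `k` of a cocycle of smallest weight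
among the basis cocycles that take the value 1 at `ζ`. -/
structure IsAlgorithmResult (K : AbstractSimplicialComplex V) (ζ : Chain K 1) {g : ℕ}
    (ν : Fin g → Cochain K 1) (k : Fin g) : Prop where
  min_basis : IsMinCohomologyBasis K ν
  sorted : Monotone fun j => weight K (ν j)
  value_one : ν k ζ = 1
  lightest : ∀ j, ν j ζ = 1 → weight K (ν k) ≤ weight K (ν j)

/-! ## Topological hitting sets -/

/-- A set of edges that meets every 1-cycle homologous to `ζ`. -/
def IsHittingSet (K : AbstractSimplicialComplex V) (ζ : Chain K 1)
    (S : Finset (Simplex K 1)) : Prop :=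
  ∀ ζ' : Chain K 1, ζ' ∈ Z₁ K → ζ' - ζ ∈ B₁ K → ∃ e ∈ S, ζ' e = 1

/-- A hitting set of minimum cardinality. -/
def IsOptimalHittingSet (K : AbstractSimplicialComplex V) (ζ : Chain K 1)
    (S : Finset (Simplex K 1)) : Prop :=
  IsHittingSet K ζ S ∧ ∀ T : Finset (Simplex K 1), IsHittingSet K ζ T → S.card ≤ T.card

end THS

/-! ## Triangulated closed surfaces -/

namespace THS

/-- The link of the vertex `v` in a complex of dimension at most 2, as a graph: its vertices are
the vertices joined to `v` by an edge, and two of them are adjacent if they span a triangle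
with `v`. -/
def linkGraph {V : Type*} [DecidableEq V] (K : AbstractSimplicialComplex V) (v : V) :
    SimpleGraph {a : V // a ≠ v ∧ ({v, a} : Finset V) ∈ K} where
  Adj a b := a ≠ b ∧ ({v, a.1, b.1} : Finset V) ∈ K
  symm := ⟨fun a b h => ⟨h.1.symm, by rw [Finset.pair_comm b.1 a.1]; exact h.2⟩⟩
  loopless := ⟨fun _ h => h.1 rfl⟩

/-- A triangulated closed surface (connected or not): a complex of dimension at most 2 in which
the link of every vertex is a cycle. -/
def IsClosedSurface {V : Type*} [DecidableEq V] (K : AbstractSimplicialComplex V) : Prop :=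
  (∀ s ∈ K, s.card ≤ 3) ∧
    ∀ v : V, ∃ m : ℕ, 3 ≤ m ∧ Nonempty (linkGraph K v ≃g SimpleGraph.cycleGraph m)

/-! ## A random access machine

Programs are syntactic objects over registers `reg 0, reg 1, …` and memory banks
`mem 0, mem 1, …`, each of which is an infinite array of natural numbers. A program mentions
finitely many of them. The only arithmetic operations are addition and truncated subtraction;
each operation and each memory access costs one step. -/

/-- The contents of the registers and of the memory banks. -/
structure State where
  reg : ℕ → ℕ
  mem : ℕ → ℕ → ℕ

/-- Expressions: a constant, a register, a cell of bank `b` at a computed address, a sum,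
a truncated difference. -/
inductive Expr where
  | const (c : ℕ)
  | reg (x : ℕ)
  | load (b : ℕ) (addr : Expr)
  | add (e₁ e₂ : Expr)
  | sub (e₁ e₂ : Expr)

/-- The value of an expression. -/
def Expr.eval (s : State) : Expr → ℕ
  | .const c => c
  | .reg x => s.reg x
  | .load b addr => s.mem b (addr.eval s)
  | .add e₁ e₂ => e₁.eval s + e₂.eval s
  | .sub e₁ e₂ => e₁.eval s - e₂.eval s

/-- The number of steps that the evaluation of an expression takes. -/
def Expr.cost : Expr → ℕ
  | .const _ => 1
  | .reg _ => 1
  | .load _ addr => addr.cost + 1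
  | .add e₁ e₂ => e₁.cost + e₂.cost + 1
  | .sub e₁ e₂ => e₁.cost + e₂.cost + 1

/-- Programs: do nothing, write a register, write a cell of bank `b`, composition, branching and
looping on whether an expression is nonzero. -/
inductive Prog where
  | skip
  | assign (x : ℕ) (e : Expr)
  | store (b : ℕ) (addr e : Expr)
  | comp (P Q : Prog)
  | branch (e : Expr) (P Q : Prog)
  | loop (e : Expr) (P : Prog)

/-- The state after register `x` has been set to `a`. -/
def State.setReg (s : State) (x a : ℕ) : State :=
  { s with reg := Function.update s.reg x a }

/-- The state after cell `i` of bank `b` has been set to `a`. -/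
def State.setMem (s : State) (b i a : ℕ) : State :=
  { s with mem := Function.update s.mem b (Function.update (s.mem b) i a) }

/-- `Exec P s t s'`: started in the state `s`, the program `P` halts after exactly `t` steps in the
state `s'`. -/
inductive Exec : Prog → State → ℕ → State → Prop where
  | skip (s : State) : Exec .skip s 1 s
  | assign (s : State) (x : ℕ) (e : Expr) :
      Exec (.assign x e) s (e.cost + 1) (s.setReg x (e.eval s))
  | store (s : State) (b : ℕ) (addr e : Expr) :
      Exec (.store b addr e) s (addr.cost + e.cost + 1) (s.setMem b (addr.eval s) (e.eval s))
  | comp {P Q : Prog} {s s₁ s₂ : State} {t₁ t₂ : ℕ} :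
      Exec P s t₁ s₁ → Exec Q s₁ t₂ s₂ → Exec (.comp P Q) s (t₁ + t₂) s₂
  | branch_true {e : Expr} {P Q : Prog} {s s' : State} {t : ℕ} :
      e.eval s ≠ 0 → Exec P s t s' → Exec (.branch e P Q) s (e.cost + 1 + t) s'
  | branch_false {e : Expr} {P Q : Prog} {s s' : State} {t : ℕ} :
      e.eval s = 0 → Exec Q s t s' → Exec (.branch e P Q) s (e.cost + 1 + t) s'
  | loop_done {e : Expr} {P : Prog} {s : State} :
      e.eval s = 0 → Exec (.loop e P) s (e.cost + 1) s
  | loop_step {e : Expr} {P : Prog} {s s₁ s₂ : State} {t₁ t₂ : ℕ} :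
      e.eval s ≠ 0 → Exec P s t₁ s₁ → Exec (.loop e P) s₁ t₂ s₂ →
        Exec (.loop e P) s (e.cost + 1 + t₁ + t₂) s₂

/-! ## Input and output of the machine -/

/-- A description of a complex with vertices `0, …, n-1` and of its edges and triangles: a list of
the edges and a list of the triangles, both without repetitions and in any order, in which each
simplex is written as a tuple of its vertices, in any order. -/
structure Listing {n : ℕ} (K : AbstractSimplicialComplex (Fin n)) where
  numEdges : ℕ
  numTriangles : ℕ
  edge : Fin numEdges ≃ Simplex K 1
  triangle : Fin numTriangles ≃ Simplex K 2
  edgeTuple : Fin numEdges → Fin n × Fin n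
  triangleTuple : Fin numTriangles → Fin n × Fin n × Fin n
  edgeTuple_spec : ∀ i, (edge i).1 = {(edgeTuple i).1, (edgeTuple i).2}
  triangleTuple_spec : ∀ i, (triangle i).1 =
    {(triangleTuple i).1, (triangleTuple i).2.1, (triangleTuple i).2.2}

/-- The number of simplices of a complex of dimension at most 2. -/
def Listing.size {n : ℕ} {K : AbstractSimplicialComplex (Fin n)} (L : Listing K) : ℕ :=
  n + L.numEdges + L.numTriangles

/-- The array with the given entries, followed by zeros. -/
def toArray {m : ℕ} (a : Fin m → ℕ) (i : ℕ) : ℕ :=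
  if h : i < m then a ⟨i, h⟩ else 0

/-- The initial state on input `(K, ζ)`: registers 0, 1, 2 hold the numbers of vertices, edges and
triangles; banks 0 and 1 hold the end points of the edges; banks 2, 3 and 4 hold the vertices of
the triangles; bank 5 holds the coefficients of `ζ`; everything else is 0. -/
def Listing.input {n : ℕ} {K : AbstractSimplicialComplex (Fin n)} (L : Listing K)
    (ζ : Chain K 1) : State where
  reg
    | 0 => n
    | 1 => L.numEdges
    | 2 => L.numTriangles
    | _ => 0
  mem
    | 0 => toArray fun i => ((L.edgeTuple i).1 : ℕ)
    | 1 => toArray fun i => ((L.edgeTuple i).2 : ℕ)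
    | 2 => toArray fun i => ((L.triangleTuple i).1 : ℕ)
    | 3 => toArray fun i => ((L.triangleTuple i).2.1 : ℕ)
    | 4 => toArray fun i => ((L.triangleTuple i).2.2 : ℕ)
    | 5 => toArray fun i => (ζ (L.edge i)).val
    | _ => fun _ => 0

/-- The state `s` holds the output `(ν, k)`: register 0 holds the number of basis cocycles,
register 1 holds the index `k`, bank 0 holds the values of the cocycles `ν 0, ν 1, …` on the edges,
one cocycle after the other, and bank 1 holds the values of the cocycle `ν k` on the edges. -/
structure Listing.IsOutput {n : ℕ} {K : AbstractSimplicialComplex (Fin n)} (L : Listing K)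
    {g : ℕ} (ν : Fin g → Cochain K 1) (k : Fin g) (s : State) : Prop where
  count : s.reg 0 = g
  index : s.reg 1 = k
  basis : ∀ (j : Fin g) (i : Fin L.numEdges),
    s.mem 0 (j * L.numEdges + i) = (ν j (single K (L.edge i))).val
  chosen : ∀ i : Fin L.numEdges, s.mem 1 i = (ν k (single K (L.edge i))).val

end THS

end

namespace THS

open Module

/-! ### Hitting sets and cocycles -/

section HittingSets

variable {V : Type*} [Finite V] {K : AbstractSimplicialComplex V} {ζ : Chain K 1}

/-! Hitting sets and cocycles are dual. A cocycle `η` with `η ζ = 1` has the value 1 at every cycle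
homologous to `ζ`, so its support meets all of them. Conversely, if `T` is a hitting set, then `ζ`
is not the sum of a boundary and a chain that avoids `T`, so some functional kills both kinds of
chains but not `ζ`; it is a cocycle with value 1 at `ζ` and support inside `T`
(`exists_cocycle_of_isHittingSet`). The optimum is therefore the least weight of a cocycle with
value 1 at `ζ`. An optimal basis attains it by exchange: when such an `η` is expanded in the basis,
some `ν j` with `ν j ζ = 1` occurs, and replacing it by `η` gives another basis, so `ν j` is not
heavier than `η`.

For the running time, every edge of a surface lies in exactly two triangles, so cocycles are the
cycles of the dual graph. Any such cycle of weight at most `w` is a sum of candidates `p a + p b +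
e`, where `p` are shortest path chains from a root `r`, `e` is an edge between the faces `a` and
`b`, and `d a + d b + 1 ≤ w` (`mem_of_shortest_candidates`). Offering these candidates for all roots
in ascending order of `w`, and keeping those independent of the coboundaries and of the earlier
choices, yields a greedy basis; comparing the numbers of members below each weight shows that it is
optimal (`IsCohomologyBasis.isMin`). Distances come from rounds of relaxation, independence from
Gaussian elimination.

The machine program is obtained from a language with counting loops only. Its effect is a function
on states, so correctness is proved with loop invariants, and its loop bounds depend only on three
registers that are never written, so a polynomial time bound is read off the syntax
(`exec_compile`). -/

lemma zmod_two_eq_one {a : ZMod 2} (h : a ≠ 0) : a = 1 := by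
  revert h; revert a; decide

lemma chain_eq_sum_single {p : ℕ} (c : Chain K p) : c = ∑ e, c e • single K e := by
  classical
  funext i
  simp [single, Finset.sum_apply, Pi.single_apply]

lemma apply_eq_sum {p : ℕ} (η : Cochain K p) (c : Chain K p) : η c = ∑ e, c e * η (single K e) := by
  conv_lhs => rw [chain_eq_sum_single c]
  simp

lemma mem_support {η : Cochain K 1} {e : Simplex K 1} :
    e ∈ support K η ↔ η (single K e) = 1 := by
  simp [support]

lemma mem_coZ₁ {η : Cochain K 1} : η ∈ coZ₁ K ↔ ∀ b ∈ B₁ K, η b = 0 := by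
  simp only [coZ₁, LinearMap.mem_ker, B₁, LinearMap.mem_range, forall_exists_index,
    forall_apply_eq_imp_iff]
  exact LinearMap.ext_iff

lemma apply_eq_zero_of_mem_coB₁ {η : Cochain K 1} (hη : η ∈ coB₁ K) (hζ : ζ ∈ Z₁ K) :
    η ζ = 0 := by
  obtain ⟨φ, rfl⟩ := hη
  have h : boundary K 0 ζ = 0 := hζ
  change φ (boundary K 0 ζ) = 0
  rw [h, map_zero]

/-- Moves questions about classes out of the quotient, to spans modulo coboundaries, which is what
the elimination decides. -/
lemma cls_mem_span_iff {S : Set (Cochain K 1)} {η : Cochain K 1} :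
    cls K η ∈ Submodule.span (ZMod 2) (cls K '' S) ↔
      η ∈ coB₁ K ⊔ Submodule.span (ZMod 2) S := by
  have h : cls K '' S = (coB₁ K).mkQ '' S := rfl
  rw [h, ← Submodule.map_span, cls, ← Submodule.mem_comap, Submodule.comap_map_mkQ]

lemma mem_support_of_apply_eq_one {η : Cochain K 1} {c : Chain K 1} (h : η c = 1) :
    ∃ e ∈ support K η, c e = 1 := by
  rw [apply_eq_sum] at h
  obtain ⟨e, -, he⟩ := Finset.exists_ne_zero_of_sum_ne_zero (h.trans_ne one_ne_zero)
  exact ⟨e, mem_support.2 (zmod_two_eq_one (right_ne_zero_of_mul he)),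
    zmod_two_eq_one (left_ne_zero_of_mul he)⟩

/-- A cocycle kills boundaries, so its value is the same on all cycles homologous to `ζ`; a value 1
forces a common edge. -/
lemma isHittingSet_support {η : Cochain K 1} (hη : η ∈ coZ₁ K) (h : η ζ = 1) :
    IsHittingSet K ζ (support K η) := by
  intro ζ' _ hb
  apply mem_support_of_apply_eq_one
  have := mem_coZ₁.1 hη _ hb
  rw [map_sub, sub_eq_zero] at this
  rw [this, h]

/-- Such an edge adds one of the two remaining vertices of `τ` to `v`. This parity is the reason for
`∂∂ = 0`. -/
lemma card_edges_between {v : Simplex K 0} {τ : Simplex K 2} (h : v.1 ⊆ τ.1) [DecidableEq V] :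
    (Finset.univ.filter fun e : Simplex K 1 => v.1 ⊆ e.1 ∧ e.1 ⊆ τ.1).card = 2 := by
  have hc : (τ.1 \ v.1).card = 2 := by
    rw [Finset.card_sdiff_of_subset h, τ.2.2, v.2.2]
  refine Eq.trans ?_ hc
  symm
  have hsub : ∀ a ∈ τ.1 \ v.1, insert a v.1 ⊆ τ.1 := fun a ha =>
    Finset.insert_subset (Finset.mem_sdiff.1 ha).1 h
  refine Finset.card_bij (fun a ha => ⟨insert a v.1,
    (K.isRelLowerSet_faces τ.2.1).2 (hsub a ha) (Finset.insert_nonempty _ _), ?_⟩) ?_ ?_ ?_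
  · rw [Finset.card_insert_of_notMem (Finset.mem_sdiff.1 ha).2, v.2.2]
  · intro a ha
    exact Finset.mem_filter.2 ⟨Finset.mem_univ _, Finset.subset_insert a v.1, hsub a ha⟩
  · intro a ha b hb hab
    have hab' : insert a v.1 = insert b v.1 := congrArg Subtype.val hab
    have : a ∈ insert b v.1 := hab' ▸ Finset.mem_insert_self a v.1
    exact (Finset.mem_insert.1 this).resolve_right (Finset.mem_sdiff.1 ha).2
  · intro e he
    simp only [Finset.mem_filter, Finset.mem_univ, true_and] at he
    have hc1 : (e.1 \ v.1).card = 1 := by rw [Finset.card_sdiff_of_subset he.1, e.2.2, v.2.2]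
    obtain ⟨a, ha⟩ := Finset.card_eq_one.1 hc1
    have hae : a ∈ e.1 \ v.1 := ha ▸ Finset.mem_singleton_self a
    rw [Finset.mem_sdiff] at hae
    refine ⟨a, Finset.mem_sdiff.2 ⟨he.2 hae.1, hae.2⟩, Subtype.ext ?_⟩
    change insert a v.1 = e.1
    rw [Finset.insert_eq, ← ha, Finset.sdiff_union_of_subset he.1]

lemma B₁_le_Z₁ : B₁ K ≤ Z₁ K := by
  classical
  rintro _ ⟨c, rfl⟩
  change boundary K 0 (boundary K 1 c) = 0
  funext v
  have h1 : boundary K 0 (boundary K 1 c) v =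
      ∑ τ : Simplex K 2, ∑ e : Simplex K 1, if v.1 ⊆ e.1 ∧ e.1 ⊆ τ.1 then c τ else 0 := by
    simp only [boundary, LinearMap.coe_mk, AddHom.coe_mk]
    rw [Finset.sum_comm]
    refine Finset.sum_congr rfl fun e _ => ?_
    by_cases h : v.1 ⊆ e.1 <;> simp [h]
  rw [h1]
  refine Finset.sum_eq_zero fun τ _ => ?_
  rw [← Finset.sum_filter, Finset.sum_const]
  by_cases h : v.1 ⊆ τ.1
  · rw [card_edges_between h, two_nsmul, CharTwo.add_self_eq_zero]
  · rw [Finset.filter_false_of_mem fun e _ he => h (he.1.trans he.2)]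
    simp

/-- Linear duality: the hitting property says that `ζ` lies outside a subspace, and a functional
that separates it from that subspace is the desired cocycle. -/
lemma exists_cocycle_of_isHittingSet (hζ : ζ ∈ Z₁ K) {T : Finset (Simplex K 1)}
    (hT : IsHittingSet K ζ T) : ∃ η ∈ coZ₁ K, η ζ = 1 ∧ support K η ⊆ T := by
  -- The chains that avoid `T`. A decomposition `ζ = b + c` with `b` a boundary and `c` in `C` would
  -- make `c` a cycle homologous to `ζ` that `T` misses.
  let C : Submodule (ZMod 2) (Chain K 1) :=
    { carrier := {c | ∀ e ∈ T, c e = 0}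
      add_mem' := fun {a b} ha hb e he => by simp [ha e he, hb e he]
      zero_mem' := fun _ _ => rfl
      smul_mem' := fun r a ha e he => by simp [ha e he] }
  have hnot : ζ ∉ B₁ K ⊔ C := by
    intro h
    obtain ⟨b, hb, c, hc, hbc⟩ := Submodule.mem_sup.1 h
    have hcζ : c = ζ - b := by rw [← hbc]; simp
    obtain ⟨e, he, h1⟩ := hT c (hcζ ▸ sub_mem hζ (B₁_le_Z₁ hb))
      (by rw [hcζ, sub_sub_cancel_left]; exact neg_mem hb)
    rw [hc e he] at h1
    exact zero_ne_one h1
  obtain ⟨η, hη, hker⟩ := Submodule.exists_le_ker_of_notMem hnot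
  refine ⟨η, mem_coZ₁.2 fun b hb => hker (Submodule.mem_sup_left hb), zmod_two_eq_one hη, ?_⟩
  intro e he
  by_contra heT
  rw [mem_support] at he
  have : single K e ∈ C := by
    intro e' he'
    have : e' ≠ e := fun h => heT (h ▸ he')
    simp [single, this]
  have h0 : η (single K e) = 0 := hker (Submodule.mem_sup_right this)
  rw [h0] at he
  exact zero_ne_one he

/-! ### Cohomology bases: exchange, existence, minimality -/

/-- A dimension count replaces spanning by the number of members, so exchanging or permuting members
requires only independence to be checked. -/
lemma isCohomologyBasis_iff {g : ℕ} {ν : Fin g → Cochain K 1} :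
    IsCohomologyBasis K ν ↔ (∀ j, ν j ∈ coZ₁ K) ∧
      LinearIndependent (ZMod 2) (fun j => cls K (ν j)) ∧ g = finrank (ZMod 2) (coH₁ K) := by
  refine ⟨fun h => ⟨h.1, h.2.1, ?_⟩, fun h => ⟨h.1, h.2.1, ?_⟩⟩
  · rw [← h.2.2, finrank_span_eq_card h.2.1, Fintype.card_fin]
  · refine Submodule.eq_of_le_of_finrank_eq ?_ ?_
    · rw [Submodule.span_le]
      rintro _ ⟨j, rfl⟩
      exact Submodule.mem_map_of_mem (h.1 j)
    · rw [finrank_span_eq_card h.2.1, Fintype.card_fin, h.2.2]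

lemma cls_mem_coH₁ {η : Cochain K 1} (h : η ∈ coZ₁ K) : cls K η ∈ coH₁ K :=
  Submodule.mem_map_of_mem h

/-- The expansion holds up to a coboundary, which vanishes at the cycle `ζ`; hence the same
coefficients express the value at `ζ`. -/
lemma IsCohomologyBasis.exists_coeff {g : ℕ} {ν : Fin g → Cochain K 1}
    (h : IsCohomologyBasis K ν) {η : Cochain K 1} (hη : η ∈ coZ₁ K) (hζ : ζ ∈ Z₁ K) :
    ∃ c : Fin g → ZMod 2, ∑ j, c j • cls K (ν j) = cls K η ∧ η ζ = ∑ j, c j * ν j ζ := by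
  have hmem := cls_mem_coH₁ hη
  rw [← h.2.2, Submodule.mem_span_range_iff_exists_fun] at hmem
  obtain ⟨c, hc⟩ := hmem
  refine ⟨c, hc, ?_⟩
  have hB : η - ∑ j, c j • ν j ∈ coB₁ K := by
    rw [← Submodule.Quotient.mk_eq_zero, ← Submodule.mkQ_apply, map_sub, map_sum, sub_eq_zero]
    simp only [map_smul]
    exact hc.symm
  have := apply_eq_zero_of_mem_coB₁ hB hζ
  rw [LinearMap.sub_apply, sub_eq_zero] at this
  rw [this]
  simp

/-- The exchange step: a basis cocycle that occurs in the expansion of a cocycle `η` can be replaced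
by `η`. -/
lemma IsCohomologyBasis.update {g : ℕ} {ν : Fin g → Cochain K 1} (h : IsCohomologyBasis K ν)
    {η : Cochain K 1} (hη : η ∈ coZ₁ K) {c : Fin g → ZMod 2}
    (hc : ∑ j, c j • cls K (ν j) = cls K η) {i : Fin g} (hi : c i ≠ 0) :
    IsCohomologyBasis K (Function.update ν i η) := by
  rw [isCohomologyBasis_iff] at h ⊢
  refine ⟨fun j => ?_, ?_, h.2.2⟩
  · by_cases hj : j = i
    · subst hj; simpa using hη
    · simpa [hj] using h.1 j
  · have heq : (fun j => cls K (Function.update ν i η j)) =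
        Function.update (fun j => cls K (ν j)) i (cls K η) := by
      funext j
      by_cases hj : j = i
      · subst hj; simp
      · simp [hj]
    rw [heq]
    -- The relation has the factor 1 on the new class and the coefficients `c` on the old ones, with
    -- `c i` nonzero.
    refine h.2.1.update i _ ⟨1, one_mem _, Finsupp.equivFunOnFinite.symm c, ?_, ?_⟩
    · exact mem_nonZeroDivisors_of_ne_zero (by simpa using hi)
    · rw [one_smul, ← hc, Finsupp.linearCombination_apply, Finsupp.sum_fintype _ _ (by simp)]
      simp

/-- An arbitrary hitting set contains the support of a cocycle `η` with `η ζ = 1`, and the exchange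
argument compares `η` with the chosen basis cocycle. -/
theorem IsAlgorithmResult.isOptimalHittingSet {g : ℕ} {ν : Fin g → Cochain K 1} {k : Fin g}
    (h : IsAlgorithmResult K ζ ν k) (hζ : ζ ∈ Z₁ K) :
    IsOptimalHittingSet K ζ (support K (ν k)) := by
  refine ⟨isHittingSet_support (h.min_basis.1.1 k) h.value_one, fun T hT => ?_⟩
  obtain ⟨η, hη, hη1, hηT⟩ := exists_cocycle_of_isHittingSet hζ hT
  obtain ⟨c, hc, hsum⟩ := h.min_basis.1.exists_coeff hη hζ
  rw [hη1] at hsum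
  -- A nonzero summand `c j * ν j ζ` makes `ν j` both exchangeable for `η` and a competitor of `ν
  -- k`.
  obtain ⟨j, -, hj⟩ := Finset.exists_ne_zero_of_sum_ne_zero (hsum.symm.trans_ne one_ne_zero)
  have hmin := h.min_basis.2 g _ (h.min_basis.1.update hη hc (left_ne_zero_of_mul hj))
  have hle := h.lightest j (zmod_two_eq_one (right_ne_zero_of_mul hj))
  have hcard : weight K η ≤ T.card := Finset.card_le_card hηT
  change weight K (ν k) ≤ T.card
  rw [← Finset.add_sum_erase _ _ (Finset.mem_univ j),
    ← Finset.add_sum_erase _ _ (Finset.mem_univ j), Function.update_self,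
    Finset.sum_congr rfl (fun i hi => by
      rw [Function.update_of_ne (Finset.ne_of_mem_erase hi)] :
      ∀ i ∈ Finset.univ.erase j, weight K (Function.update ν j η i) = weight K (ν i))] at hmin
  omega

variable (K) in
lemma exists_isCohomologyBasis : ∃ (g : ℕ) (ν : Fin g → Cochain K 1), IsCohomologyBasis K ν := by
  let b := finBasis (ZMod 2) (coH₁ K)
  choose ν hν hνb using fun j => (b j).2
  refine ⟨_, ν, isCohomologyBasis_iff.2 ⟨hν, ?_, rfl⟩⟩
  have : (fun j => cls K (ν j)) = fun j => ((b j : coH₁ K) : Cochain K 1 ⧸ coB₁ K) :=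
    funext hνb
  rw [this]
  exact b.linearIndependent.map' (coH₁ K).subtype (Submodule.ker_subtype _)

lemma IsCohomologyBasis.comp_perm {g : ℕ} {ν : Fin g → Cochain K 1} (h : IsCohomologyBasis K ν)
    (σ : Equiv.Perm (Fin g)) : IsCohomologyBasis K (ν ∘ σ) := by
  rw [isCohomologyBasis_iff] at h ⊢
  exact ⟨fun j => h.1 _, h.2.1.comp _ σ.injective, h.2.2⟩

theorem exists_isAlgorithmResult (hζ : ζ ∈ Z₁ K) (hζB : ζ ∉ B₁ K) :
    ∃ (g : ℕ) (ν : Fin g → Cochain K 1) (k : Fin g), IsAlgorithmResult K ζ ν k := by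
  classical
  have hex : ∃ N g, ∃ ν : Fin g → Cochain K 1, IsCohomologyBasis K ν ∧ ∑ j, weight K (ν j) = N := by
    obtain ⟨g, ν, h⟩ := exists_isCohomologyBasis K
    exact ⟨_, g, ν, h, rfl⟩
  obtain ⟨g, ν, hν, hN⟩ := Nat.find_spec hex
  have hmin : ∀ (g' : ℕ) (ν' : Fin g' → Cochain K 1), IsCohomologyBasis K ν' →
      ∑ j, weight K (ν j) ≤ ∑ j, weight K (ν' j) := fun g' ν' h' =>
    hN.trans_le (Nat.find_min' hex ⟨g', ν', h', rfl⟩)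
  let σ := Tuple.sort fun j => weight K (ν j)
  have hb := hν.comp_perm σ
  -- Some cocycle is nonzero at `ζ` because `ζ` is not a boundary; by its expansion, some basis
  -- member is nonzero there too.
  obtain ⟨η, hη, hker⟩ := Submodule.exists_le_ker_of_notMem hζB
  obtain ⟨c, -, hsum⟩ := hb.exists_coeff (mem_coZ₁.2 hker) hζ
  obtain ⟨j, -, hj⟩ := Finset.exists_ne_zero_of_sum_ne_zero (hsum.symm.trans_ne hη)
  obtain ⟨k, hk, hkmin⟩ := (Finset.univ.filter fun j => (ν ∘ σ) j ζ = 1).exists_min_image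
    (fun j => weight K ((ν ∘ σ) j))
    ⟨j, by simpa using zmod_two_eq_one (right_ne_zero_of_mul hj)⟩
  simp only [Finset.mem_filter, Finset.mem_univ, true_and] at hk hkmin
  refine ⟨g, ν ∘ σ, k, ⟨hb, fun g' ν' h' => ?_⟩, Tuple.monotone_sort fun j => weight K (ν j), hk, hkmin⟩
  refine le_trans (le_of_eq ?_) (hmin g' ν' h')
  exact Equiv.sum_comp σ fun j => weight K (ν j)

/-- A cohomology basis is minimum if every cocycle is cohomologous to a combination of basis
cocycles that are not heavier. -/
theorem IsCohomologyBasis.isMin {g : ℕ} {ν : Fin g → Cochain K 1} (h : IsCohomologyBasis K ν)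
    (hspan : ∀ η ∈ coZ₁ K, cls K η ∈ Submodule.span (ZMod 2)
      ((fun j => cls K (ν j)) '' {j | weight K (ν j) ≤ weight K η})) :
    IsMinCohomologyBasis K ν := by
  classical
  refine ⟨h, fun g' ν' h' => ?_⟩
  obtain rfl : g = g' := (isCohomologyBasis_iff.1 h).2.2.trans (isCohomologyBasis_iff.1 h').2.2.symm
  -- At each threshold `w`, the light members of `ν'` are independent and lie in the span of the
  -- light members of `ν`.
  have key : ∀ w, (Finset.univ.filter fun j => weight K (ν' j) ≤ w).card ≤
      (Finset.univ.filter fun j => weight K (ν j) ≤ w).card := by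
    intro w
    let S' := {j // weight K (ν' j) ≤ w}
    let S := {j // weight K (ν j) ≤ w}
    have h1 : LinearIndependent (ZMod 2) fun j : S' => cls K (ν' j) :=
      h'.2.1.comp _ Subtype.val_injective
    have h2 : LinearIndependent (ZMod 2) fun j : S => cls K (ν j) :=
      h.2.1.comp _ Subtype.val_injective
    have hle : Submodule.span (ZMod 2) (Set.range fun j : S' => cls K (ν' j)) ≤
        Submodule.span (ZMod 2) (Set.range fun j : S => cls K (ν j)) := by
      rw [Submodule.span_le]
      rintro _ ⟨j, rfl⟩
      refine Submodule.span_mono ?_ (hspan _ (h'.1 j))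
      rintro _ ⟨i, hi, rfl⟩
      exact ⟨⟨i, le_trans hi j.2⟩, rfl⟩
    have := Submodule.finrank_mono hle
    rwa [finrank_span_eq_card h1, finrank_span_eq_card h2, Fintype.card_subtype,
      Fintype.card_subtype] at this
  obtain ⟨M, hM⟩ : ∃ M, ∀ j, weight K (ν j) ≤ M ∧ weight K (ν' j) ≤ M := by
    refine ⟨∑ j, (weight K (ν j) + weight K (ν' j)), fun j => ?_⟩
    have := Finset.single_le_sum (f := fun j => weight K (ν j) + weight K (ν' j))
      (fun _ _ => Nat.zero_le _) (Finset.mem_univ j)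
    beta_reduce at this
    omega
  -- Summation by layers: a weight `a ≤ M` equals `M` minus the number of `w < M` with `a ≤ w`. More
  -- light members thus mean a smaller total.
  have layer : ∀ μ : Fin g → Cochain K 1, (∀ j, weight K (μ j) ≤ M) →
      ∑ j, weight K (μ j) + ∑ w ∈ Finset.range M,
        (Finset.univ.filter fun j => weight K (μ j) ≤ w).card = g * M := by
    intro μ hμ
    simp_rw [Finset.card_filter]
    rw [Finset.sum_comm, ← Finset.sum_add_distrib]
    have : ∀ j, weight K (μ j) + ∑ w ∈ Finset.range M, (if weight K (μ j) ≤ w then 1 else 0) = M := by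
      intro j
      rw [← Finset.card_filter]
      have : (Finset.range M).filter (fun w => weight K (μ j) ≤ w) =
          Finset.Ico (weight K (μ j)) M := by
        ext w; simp [and_comm]
      rw [this, Nat.card_Ico]
      have := hμ j
      omega
    simp_rw [← Finset.card_filter] at this ⊢
    rw [Finset.sum_congr rfl fun j _ => this j]
    simp
  have e1 := layer ν fun j => (hM j).1
  have e2 := layer ν' fun j => (hM j).2
  have e3 := Finset.sum_le_sum fun w (_ : w ∈ Finset.range M) => key w
  omega

end HittingSets

end THS

namespace THS

/-! ## Programs with bounded loops -/

/-- Programs whose only loops are counting loops: `loop i b c` runs `c` with the counter register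
`i` equal to `0, 1, …` below the value of `b`. -/
inductive Cmd where
  | skip
  | assign (x : ℕ) (e : Expr)
  | store (b : ℕ) (addr e : Expr)
  | seq (c d : Cmd)
  | cond (e : Expr) (c d : Cmd)
  | loop (i : ℕ) (b : Expr) (c : Cmd)

namespace Cmd

/-- The effect of a program with bounded loops. -/
def run : Cmd → State → State
  | .skip, s => s
  | .assign x e, s => s.setReg x (e.eval s)
  | .store b a e, s => s.setMem b (a.eval s) (e.eval s)
  | .seq c d, s => d.run (c.run s)
  | .cond e c d, s => if e.eval s ≠ 0 then c.run s else d.run s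
  | .loop i b c, s =>
    Nat.rec (s.setReg i 0) (fun k s' => (c.run s').setReg i (k + 1)) (b.eval s)

/-- The translation into a program of the random access machine. -/
def compile : Cmd → Prog
  | .skip => .skip
  | .assign x e => .assign x e
  | .store b a e => .store b a e
  | .seq c d => .comp c.compile d.compile
  | .cond e c d => .branch e c.compile d.compile
  -- The truncated difference is nonzero exactly while the counter is below the bound. The machine
  -- evaluates the bound again at every test, whereas `run` evaluates it once; `WF` makes the two
  -- agree.
  | .loop i b c => .comp (.assign i (.const 0)) (.loop (.sub b (.reg i))
      (.comp c.compile (.assign i (.add (.reg i) (.const 1)))))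

/-- The registers that a program may write. -/
def regs : Cmd → List ℕ
  | .skip => []
  | .assign x _ => [x]
  | .store _ _ _ => []
  | .seq c d => c.regs ++ d.regs
  | .cond _ c d => c.regs ++ d.regs
  | .loop i _ c => i :: c.regs

/-- The memory banks that a program may write. -/
def banks : Cmd → List ℕ
  | .skip => []
  | .assign _ _ => []
  | .store b _ _ => [b]
  | .seq c d => c.banks ++ d.banks
  | .cond _ c d => c.banks ++ d.banks
  | .loop _ _ c => c.banks

/-- Expressions that are bounded polynomially in the registers 0, 1, 2. -/
def isBound : Expr → Bool
  | .const _ => true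
  | .reg x => decide (x < 3)
  | .load _ _ => false
  | .add a b => isBound a && isBound b
  | .sub _ _ => false

/-- The program does not write the registers 0, 1, 2, the number of runs through each loop is
determined by these registers, and loop counters are not written inside the loop. -/
def WF : Cmd → Bool
  | .skip => true
  | .assign x _ => decide (3 ≤ x)
  | .store _ _ _ => true
  | .seq c d => c.WF && d.WF
  | .cond _ c d => c.WF && d.WF
  | .loop i b c => isBound b && decide (3 ≤ i) && decide (i ∉ c.regs) && c.WF

open Polynomial in
/-- A polynomial bound on a loop bound. -/
noncomputable def boundPoly : Expr → Polynomial ℕ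
  | .const c => C c
  | .reg _ => X
  | .load _ _ => 0
  | .add a b => boundPoly a + boundPoly b
  | .sub _ _ => 0

open Polynomial in
/-- A polynomial bound on the running time. -/
noncomputable def time : Cmd → Polynomial ℕ
  | .skip => 1
  | .assign _ e => C (e.cost + 1)
  | .store _ a e => C (a.cost + e.cost + 1)
  | .seq c d => c.time + d.time
  | .cond e c d => C (e.cost + 1) + c.time + d.time
  -- Setting the counter costs 2, each round costs a test, the body and 4 for the increment, and one
  -- failing test ends the loop.
  | .loop i b c => C 2 + boundPoly b * (C ((Expr.sub b (.reg i)).cost + 1) + c.time + C 4) +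
      C ((Expr.sub b (.reg i)).cost + 1)

end Cmd

@[simp] lemma State.setReg_reg (s : State) (x a y : ℕ) :
    (s.setReg x a).reg y = if y = x then a else s.reg y := by
  simp [State.setReg, Function.update_apply]

@[simp] lemma State.setReg_mem (s : State) (x a : ℕ) : (s.setReg x a).mem = s.mem := rfl

@[simp] lemma State.setMem_reg (s : State) (b i a : ℕ) : (s.setMem b i a).reg = s.reg := rfl

@[simp] lemma State.setMem_mem (s : State) (b i a b' j : ℕ) :
    (s.setMem b i a).mem b' j = if b' = b ∧ j = i then a else s.mem b' j := by
  by_cases h : b' = b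
  · subst h; simp [State.setMem, Function.update_apply]
  · simp [State.setMem, h]

/-! ### Rules for the effect and the running time of bounded-loop programs -/

namespace Cmd

lemma run_cond_pos {e : Expr} {c d : Cmd} {s : State} (h : e.eval s ≠ 0) :
    (cond e c d).run s = c.run s := if_pos h

lemma run_cond_neg {e : Expr} {c d : Cmd} {s : State} (h : e.eval s = 0) :
    (cond e c d).run s = d.run s := if_neg (not_not.2 h)

lemma run_reg (c : Cmd) {x : ℕ} (h : x ∉ c.regs) (s : State) : (c.run s).reg x = s.reg x := by
  induction c generalizing s with
  | skip => rfl
  | assign y e => simp_all [run, regs]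
  | store b a e => simp [run]
  | seq c d ihc ihd =>
    simp only [regs, List.mem_append, not_or] at h
    rw [run, ihd h.2, ihc h.1]
  | cond e c d ihc ihd =>
    simp only [regs, List.mem_append, not_or] at h
    rw [run]
    split_ifs
    · exact ihc h.1 s
    · exact ihd h.2 s
  | loop i b c ih =>
    simp only [regs, List.mem_cons, not_or] at h
    rw [run]
    induction b.eval s with
    | zero => simp [h.1]
    | succ k ihk => simp only [State.setReg_reg, h.1, if_false]; rw [ih h.2]; exact ihk

lemma run_mem (c : Cmd) {b : ℕ} (h : b ∉ c.banks) (s : State) : (c.run s).mem b = s.mem b := by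
  induction c generalizing s with
  | skip => rfl
  | assign y e => rfl
  | store b' a e =>
    funext j
    simp only [banks, List.mem_singleton] at h
    simp [run, h]
  | seq c d ihc ihd =>
    simp only [banks, List.mem_append, not_or] at h
    rw [run, ihd h.2, ihc h.1]
  | cond e c d ihc ihd =>
    simp only [banks, List.mem_append, not_or] at h
    rw [run]
    split_ifs
    · exact ihc h.1 s
    · exact ihd h.2 s
  | loop i b c ih =>
    rw [run]
    induction b.eval s with
    | zero => rfl
    | succ k ihk => rw [State.setReg_mem, ih h]; exact ihk

/-- The states `s` and `s'` agree outside the registers and banks that `c` may write. -/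
def Frame (c : Cmd) (s s' : State) : Prop :=
  (∀ x, x ∉ c.regs → s'.reg x = s.reg x) ∧ ∀ b, b ∉ c.banks → s'.mem b = s.mem b

/-- For concrete programs the lists of written registers and banks are computed, so `decide` settles
what a program leaves untouched. -/
lemma frame (c : Cmd) (s : State) : c.Frame s (c.run s) :=
  ⟨fun _ h => c.run_reg h s, fun _ h => c.run_mem h s⟩

/-- The invariant rule for loops. -/
lemma run_loop {i : ℕ} {b : Expr} {c : Cmd} {s : State} (I : ℕ → State → Prop)
    (h0 : I 0 (s.setReg i 0))
    (hs : ∀ k < b.eval s, ∀ s', (loop i b c).Frame s s' → s'.reg i = k → I k s' →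
      I (k + 1) ((c.run s').setReg i (k + 1))) :
    I (b.eval s) ((loop i b c).run s) ∧ ((loop i b c).run s).reg i = b.eval s := by
  rw [run]
  -- The frame condition and the counter value are carried through the induction along with `I`, so
  -- that the step hypothesis can use them.
  suffices h : ∀ k ≤ b.eval s, ∀ s', s' = (Nat.rec (s.setReg i 0)
      (fun k s' => (c.run s').setReg i (k + 1)) k : State) →
      (loop i b c).Frame s s' ∧ s'.reg i = k ∧ I k s' from
    have := h _ le_rfl _ rfl
    ⟨this.2.2, this.2.1⟩
  intro k
  induction k with
  | zero =>
    rintro - s' rfl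
    refine ⟨⟨fun x hx => ?_, fun b _ => rfl⟩, by simp, h0⟩
    simp only [regs, List.mem_cons, not_or] at hx
    simp [hx.1]
  | succ k ih =>
    rintro hk s' rfl
    obtain ⟨hF, hi, hI⟩ := ih (Nat.le_of_succ_le hk) _ rfl
    refine ⟨⟨fun x hx => ?_, fun b' hb => ?_⟩, by simp, hs k hk _ hF hi hI⟩
    · have hx' := hx
      simp only [regs, List.mem_cons, not_or] at hx'
      simp only [State.setReg_reg, hx'.1, if_false]
      rw [run_reg c hx'.2]
      exact hF.1 x hx
    · rw [State.setReg_mem, run_mem c hb]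
      exact hF.2 b' hb

lemma WF.three_le {c : Cmd} (h : c.WF) {x : ℕ} (hx : x ∈ c.regs) : 3 ≤ x := by
  induction c with
  | skip => simp [regs] at hx
  | assign y e => simp_all [regs, WF]
  | store b a e => simp [regs] at hx
  | seq c d ihc ihd =>
    simp only [WF, Bool.and_eq_true, regs, List.mem_append] at h hx
    exact hx.elim (ihc h.1) (ihd h.2)
  | cond e c d ihc ihd =>
    simp only [WF, Bool.and_eq_true, regs, List.mem_append] at h hx
    exact hx.elim (ihc h.1) (ihd h.2)
  | loop i b c ih =>
    simp only [WF, Bool.and_eq_true, regs, List.mem_cons, decide_eq_true_eq] at h hx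
    exact hx.elim (fun hx => hx ▸ h.1.1.2) (ih h.2)

lemma eval_congr_of_isBound {b : Expr} (hb : isBound b) {s s' : State}
    (h : ∀ x < 3, s'.reg x = s.reg x) : b.eval s' = b.eval s := by
  induction b with
  | const c => rfl
  | reg x => exact h x (by simpa [isBound] using hb)
  | load _ _ => simp [isBound] at hb
  | add a b iha ihb =>
    simp only [isBound, Bool.and_eq_true] at hb
    rw [Expr.eval, Expr.eval, iha hb.1, ihb hb.2]
  | sub _ _ => simp [isBound] at hb

lemma eval_le_boundPoly {b : Expr} (hb : isBound b) (s : State) :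
    b.eval s ≤ (boundPoly b).eval (s.reg 0 + s.reg 1 + s.reg 2) := by
  induction b with
  | const c => simp [Expr.eval, boundPoly]
  | reg x =>
    have hx : x < 3 := by simpa [isBound] using hb
    simp only [Expr.eval, boundPoly, Polynomial.eval_X]
    interval_cases x <;> omega
  | load _ _ => simp [isBound] at hb
  | add a b iha ihb =>
    simp only [isBound, Bool.and_eq_true] at hb
    simpa [Expr.eval, boundPoly] using add_le_add (iha hb.1) (ihb hb.2)
  | sub _ _ => simp [isBound] at hb

/-- The registers 0, 1, 2 are never written. Hence every loop bound keeps its value during the loop,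
and one polynomial in their sum bounds the cost of the body in every round. -/
theorem exec_compile {c : Cmd} (h : c.WF) (s : State) :
    ∃ t ≤ c.time.eval (s.reg 0 + s.reg 1 + s.reg 2), Exec c.compile s t (c.run s) := by
  induction c generalizing s with
  | skip => exact ⟨1, by simp [time], .skip s⟩
  | assign x e => exact ⟨_, by simp [time], .assign s x e⟩
  | store b a e => exact ⟨_, by simp [time], .store s b a e⟩
  | seq c d ihc ihd =>
    simp only [WF, Bool.and_eq_true] at h
    obtain ⟨t₁, ht₁, h₁⟩ := ihc h.1 s
    obtain ⟨t₂, ht₂, h₂⟩ := ihd h.2 (c.run s)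
    have hr : ∀ x < 3, (c.run s).reg x = s.reg x := fun x hx =>
      c.run_reg (fun hmem => by have := WF.three_le h.1 hmem; omega) s
    rw [hr 0 (by omega), hr 1 (by omega), hr 2 (by omega)] at ht₂
    exact ⟨_, by simpa [time] using add_le_add ht₁ ht₂, .comp h₁ h₂⟩
  | cond e c d ihc ihd =>
    simp only [WF, Bool.and_eq_true] at h
    by_cases he : e.eval s = 0
    · obtain ⟨t, ht, hx⟩ := ihd h.2 s
      refine ⟨_, ?_, by rw [run, if_neg (not_not.2 he)]; exact .branch_false he hx⟩
      simp only [time, Polynomial.eval_add, Polynomial.eval_C]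
      omega
    · obtain ⟨t, ht, hx⟩ := ihc h.1 s
      refine ⟨_, ?_, by rw [run, if_pos he]; exact .branch_true he hx⟩
      simp only [time, Polynomial.eval_add, Polynomial.eval_C]
      omega
  | loop i b c ih =>
    simp only [WF, Bool.and_eq_true, decide_eq_true_eq] at h
    obtain ⟨⟨⟨hb, hi⟩, hic⟩, hc⟩ := h
    set N := s.reg 0 + s.reg 1 + s.reg 2 with hN
    -- The state at the beginning of round `k`.
    let f : ℕ → State := fun k =>
      Nat.rec (s.setReg i 0) (fun k s' => (c.run s').setReg i (k + 1)) k
    have hreg : ∀ k, ∀ x < 3, (f k).reg x = s.reg x := by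
      intro k x hx
      induction k with
      | zero =>
        change (s.setReg i 0).reg x = _
        rw [State.setReg_reg, if_neg (by omega)]
      | succ k ihk =>
        change ((c.run (f k)).setReg i (k + 1)).reg x = _
        rw [State.setReg_reg, if_neg (by omega),
          c.run_reg (fun hmem => by have := WF.three_le hc hmem; omega), ihk]
    have hcount : ∀ k, (f k).reg i = k := by
      intro k
      cases k with
      | zero => change (s.setReg i 0).reg i = _; simp
      | succ k => change ((c.run (f k)).setReg i (k + 1)).reg i = _; simp
    set q := (Expr.sub b (.reg i)).cost with hq
    set T := c.time.eval N with hT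
    -- Induction on the number `d` of rounds that remain, since the execution relation unfolds a
    -- loop from its first round.
    have key : ∀ d k, k + d = b.eval s → ∃ t ≤ d * (q + 1 + T + 4) + (q + 1),
        Exec (.loop (.sub b (.reg i)) (.comp c.compile (.assign i (.add (.reg i) (.const 1)))))
          (f k) t (f (b.eval s)) := by
      intro d
      induction d with
      | zero =>
        intro k hk
        rw [add_zero] at hk
        subst hk
        refine ⟨_, by simp [hq], .loop_done ?_⟩
        simp only [Expr.eval, eval_congr_of_isBound hb (hreg _), hcount, Nat.sub_self]
      | succ d ihd =>
        intro k hk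
        obtain ⟨t₂, ht₂, h₂⟩ := ihd (k + 1) (by omega)
        obtain ⟨t₁, ht₁, h₁⟩ := ih hc (f k)
        rw [hreg k 0 (by omega), hreg k 1 (by omega), hreg k 2 (by omega)] at ht₁
        have hstep : Exec (.assign i (.add (.reg i) (.const 1))) (c.run (f k)) 4 (f (k + 1)) := by
          have := Exec.assign (c.run (f k)) i (.add (.reg i) (.const 1))
          simp only [Expr.eval, c.run_reg hic, hcount] at this
          exact this
        refine ⟨_, ?_, .loop_step ?_ (.comp h₁ hstep) h₂⟩
        · have ht₁' : t₁ ≤ T := ht₁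
          rw [← hq, Nat.succ_mul]
          omega
        · simp only [Expr.eval, eval_congr_of_isBound hb (hreg _), hcount]
          omega
    obtain ⟨t, ht, hx⟩ := key (b.eval s) 0 (by omega)
    have h0 : Exec (.assign i (.const 0)) s 2 (f 0) := Exec.assign s i (.const 0)
    refine ⟨_, ?_, .comp h0 hx⟩
    simp only [time, Polynomial.eval_add, Polynomial.eval_mul, Polynomial.eval_C, ← hq, ← hT]
    have := Nat.mul_le_mul_right (q + 1 + T + 4) (eval_le_boundPoly hb s)
    rw [← hN] at this
    omega

end Cmd

end THS

namespace THS

open Finset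

/-! ## Cocycles of a surface as cycles of the dual graph -/

section DualGraph

set_option linter.unusedSectionVars false

variable {E F : Type*} [Fintype E]

/-- The number of nonzero coordinates of a vector. -/
def wt (η : E → ZMod 2) : ℕ := #{e | η e ≠ 0}

lemma add_self_vec {α : Type*} (v : α → ZMod 2) : v + v = 0 :=
  funext fun _ => CharTwo.add_self_eq_zero _

lemma add_add_cancel_vec {α : Type*} (u v : α → ZMod 2) : u + v + v = u := by
  rw [add_assoc, add_self_vec, add_zero]

lemma wt_eq_zero {η : E → ZMod 2} : wt η = 0 ↔ η = 0 := by
  simp [wt, funext_iff]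

lemma wt_le_card (η : E → ZMod 2) : wt η ≤ Fintype.card E := card_filter_le _ _

lemma wt_add_le (η θ : E → ZMod 2) : wt (η + θ) ≤ wt η + wt θ := by
  classical
  refine (card_le_card fun e he => ?_).trans (card_union_le _ _)
  simp only [mem_filter, mem_univ, true_and, mem_union, Pi.add_apply] at he ⊢
  by_contra! h
  simp [h.1, h.2] at he

variable [DecidableEq E]

lemma wt_single (e : E) : wt (Pi.single e 1 : E → ZMod 2) = 1 := by
  have : (univ.filter fun i => (Pi.single e 1 : E → ZMod 2) i ≠ 0) = {e} := by
    ext i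
    by_cases h : i = e <;> simp [h]
  rw [wt, this, card_singleton]

lemma wt_add_single {η : E → ZMod 2} {e : E} (h : η e ≠ 0) :
    wt (η + Pi.single e 1) + 1 = wt η := by
  have : (univ.filter fun i => (η + Pi.single e 1 : E → ZMod 2) i ≠ 0) =
      (univ.filter fun i => η i ≠ 0).erase e := by
    ext i
    by_cases hi : i = e
    · subst hi
      have := zmod_two_eq_one h
      simp [this, CharTwo.add_self_eq_zero]
    · simp [hi]
  rw [wt, this, card_erase_add_one (by simpa using h), wt]

open Classical in
/-- The boundary map of the dual graph, whose vertices are the faces `F` and whose edges are the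
edges `E`, with the incidence relation `inc`. -/
noncomputable def dualBdry (inc : F → E → Prop) : (E → ZMod 2) →ₗ[ZMod 2] (F → ZMod 2) where
  toFun η t := ∑ e, if inc t e then η e else 0
  map_add' η θ := by
    funext t
    simp only [Pi.add_apply, ← sum_add_distrib]
    refine sum_congr rfl fun σ _ => ?_
    split_ifs <;> simp
  map_smul' a η := by
    funext t
    simp [mul_sum]

/-- Every edge lies in exactly two faces. -/
def TwoFaces (inc : F → E → Prop) : Prop :=
  ∀ e, ∃ a b, a ≠ b ∧ ∀ t, inc t e ↔ t = a ∨ t = b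

variable [DecidableEq F] {inc : F → E → Prop}

lemma dualBdry_single (h2 : TwoFaces inc) {e : E} {a b : F} (hab : a ≠ b) (ha : inc a e)
    (hb : inc b e) : dualBdry inc (Pi.single e 1) = Pi.single a 1 + Pi.single b 1 := by
  classical
  obtain ⟨x, y, hxy, h⟩ := h2 e
  have hmem : ∀ t, inc t e ↔ t = a ∨ t = b := by
    intro t
    have h1 := (h a).1 ha
    have h2 := (h b).1 hb
    rw [h]
    grind
  funext t
  have : dualBdry inc (Pi.single e 1) t = if inc t e then 1 else 0 := by
    simp only [dualBdry, LinearMap.coe_mk, AddHom.coe_mk]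
    rw [sum_eq_single e]
    · simp
    · intro i _ hi; simp [hi]
    · simp
  rw [this]
  by_cases hta : t = a
  · subst hta; simp [ha, hab]
  · by_cases htb : t = b
    · subst htb; simp [hb, hta]
    · simp [hmem, hta, htb]

lemma TwoFaces.exists_other (h2 : TwoFaces inc) {e : E} {a : F} (ha : inc a e) :
    ∃ b, a ≠ b ∧ inc b e := by
  obtain ⟨x, y, hxy, h⟩ := h2 e
  rcases (h a).1 ha with rfl | rfl
  · exact ⟨y, hxy, (h y).2 (Or.inr rfl)⟩
  · exact ⟨x, hxy.symm, (h x).2 (Or.inl rfl)⟩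

lemma exists_edge_of_dualBdry_ne_zero {θ : E → ZMod 2} {u : F} (h : dualBdry inc θ u ≠ 0) :
    ∃ e, inc u e ∧ θ e ≠ 0 := by
  classical
  obtain ⟨e, -, he⟩ := exists_ne_zero_of_sum_ne_zero h
  by_cases hi : inc u e
  · exact ⟨e, hi, by simpa [hi] using he⟩
  · simp [hi] at he

/-- Shortest path chains from the face `r`: the chain `p u` has boundary `r + u` and minimum weight
`d u` among all such chains, unless there is none; then `d u` exceeds the number of edges. -/
structure IsShortest (inc : F → E → Prop) (r : F) (d : F → ℕ) (p : F → E → ZMod 2) : Prop where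
  bdry : ∀ u, d u ≤ Fintype.card E → dualBdry inc (p u) = Pi.single r 1 + Pi.single u 1
  wt_le : ∀ u, d u ≤ Fintype.card E → wt (p u) ≤ d u
  le_wt : ∀ u θ, dualBdry inc θ = Pi.single r 1 + Pi.single u 1 → d u ≤ wt θ

namespace IsShortest

variable {r : F} {d : F → ℕ} {p : F → E → ZMod 2}

lemma root_eq_zero (h : IsShortest inc r d p) : d r = 0 ∧ p r = 0 := by
  have h0 : d r = 0 := by
    have := h.le_wt r 0 (by rw [map_zero, add_self_vec])
    rwa [wt_eq_zero.2 rfl, Nat.le_zero] at this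
  have := h.wt_le r (by omega)
  exact ⟨h0, wt_eq_zero.1 (by omega)⟩

/-- The chain `p a + e` competes with `p b`. -/
lemma dist_le_add_one (h : IsShortest inc r d p) (h2 : TwoFaces inc) {e : E} {a b : F}
    (hab : a ≠ b) (ha : inc a e) (hb : inc b e) (hd : d a ≤ Fintype.card E) : d b ≤ d a + 1 := by
  have h1 := h.le_wt b (p a + Pi.single e 1) (by
    rw [map_add, h.bdry a hd, dualBdry_single h2 hab ha hb, ← add_assoc, add_add_cancel_vec])
  have h3 := wt_add_le (p a) (Pi.single e 1)
  have h4 := h.wt_le a hd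
  rw [wt_single] at h3
  omega

/-- Walk back along `θ` from `u` to `r`. If `e` is an edge of `θ` at `u` with other face `u'`, then
`θ + p u` is the sum of `(θ + e) + p u'` and the candidate of `e`. Passing to `u'` shortens the
chain by 1 and raises the distance by at most 1, so `d u + wt θ ≤ w` persists. If `r` is reached
early, what remains is a cycle of weight below `n`, covered by `hsmall`. -/
lemma mem_of_candidates (h : IsShortest inc r d p) (h2 : TwoFaces inc) {w n : ℕ}
    {S : Submodule (ZMod 2) (E → ZMod 2)}
    (hS : ∀ e a b, a ≠ b → inc a e → inc b e → d a + d b + 1 ≤ w → p a + p b + Pi.single e 1 ∈ S)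
    (hsmall : ∀ θ, dualBdry inc θ = 0 → wt θ < n → wt θ ≤ w → θ ∈ S) :
    ∀ k θ u, wt θ = k → wt θ < n → dualBdry inc θ = Pi.single r 1 + Pi.single u 1 →
      d u + wt θ ≤ w → θ + p u ∈ S := by
  intro k
  induction k with
  | zero =>
    intro θ u hk hn hθ hw
    obtain rfl := wt_eq_zero.1 hk
    rw [map_zero] at hθ
    by_cases hu : u = r
    · subst hu
      rw [h.root_eq_zero.2]
      exact S.add_mem S.zero_mem S.zero_mem
    · have := congrFun hθ u
      simp [hu] at this
  | succ k ih =>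
    intro θ u hk hn hθ hw
    by_cases hu : u = r
    · subst hu
      rw [h.root_eq_zero.2, add_zero]
      exact hsmall θ (by rw [hθ, add_self_vec]) hn (by omega)
    · obtain ⟨e, he, hne⟩ := exists_edge_of_dualBdry_ne_zero (inc := inc) (θ := θ) (u := u)
        (by rw [hθ]; simp [hu])
      obtain ⟨u', huu', he'⟩ := h2.exists_other he
      have hwt := wt_add_single hne
      have hdu := (h.le_wt u θ hθ).trans (wt_le_card θ)
      have hθ' : dualBdry inc (θ + Pi.single e 1) = Pi.single r 1 + Pi.single u' 1 := by
        rw [map_add, hθ, dualBdry_single h2 huu' he he', ← add_assoc, add_add_cancel_vec]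
      have hd' := h.dist_le_add_one h2 huu' he he' hdu
      have hd'' := h.le_wt u' _ hθ'
      have m1 := ih _ u' (by omega) (by omega) hθ' (by omega)
      -- The candidate is light enough because `d u' ≤ wt θ - 1`, whence `d u + d u' + 1 ≤ d u + wt
      -- θ ≤ w`.
      have m2 := hS e u u' huu' he he' (by omega)
      have : θ + p u = θ + Pi.single e 1 + p u' + (p u + p u' + Pi.single e 1) := by
        have : θ + Pi.single e 1 + p u' + (p u + p u' + Pi.single e 1) =
          θ + p u + (Pi.single e 1 + Pi.single e 1) + (p u' + p u') := by abel
        rw [this, add_self_vec, add_self_vec, add_zero, add_zero]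
      rw [this]
      exact S.add_mem m1 m2

end IsShortest

/-- Every cycle of the dual graph is a sum of fundamental cycles of shortest path chains that are
not heavier. -/
theorem mem_of_shortest_candidates (h2 : TwoFaces inc) {w : ℕ}
    {S : Submodule (ZMod 2) (E → ZMod 2)}
    (hS : ∀ r, ∃ d p, IsShortest inc r d p ∧ ∀ e a b, a ≠ b → inc a e → inc b e →
      d a + d b + 1 ≤ w → p a + p b + Pi.single e 1 ∈ S)
    {η : E → ZMod 2} (hη : dualBdry inc η = 0) (hw : wt η ≤ w) : η ∈ S := by
  induction hn : wt η using Nat.strong_induction_on generalizing η with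
  | _ n ih =>
  by_cases h0 : η = 0
  · exact h0 ▸ S.zero_mem
  · obtain ⟨e, he⟩ := Function.ne_iff.1 h0
    -- Root the paths at a face on the cycle. Removing `e` leaves a chain from `r` to `s` of weight
    -- `wt η - 1`, while `e` itself gives `d s ≤ 1`; so the walk starts within the budget `w`.
    obtain ⟨r, s, hrs, hinc⟩ := h2 e
    have hr := (hinc r).2 (Or.inl rfl)
    have hs := (hinc s).2 (Or.inr rfl)
    obtain ⟨d, p, h, hc⟩ := hS r
    have hwt := wt_add_single he
    have hb : dualBdry inc (η + Pi.single e 1) = Pi.single r 1 + Pi.single s 1 := by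
      rw [map_add, hη, zero_add, dualBdry_single h2 hrs hr hs]
    have hd := h.le_wt s _ (dualBdry_single h2 hrs hr hs)
    rw [wt_single] at hd
    have hd' := h.le_wt s _ hb
    have m1 := h.mem_of_candidates h2 hc (n := n)
      (fun θ hθ h1 h3 => ih _ h1 hθ h3 rfl) _ _ s rfl (by omega) hb (by omega)
    -- The candidate of the removed edge is `p s + e`, since `p r = 0`; adding it closes the cycle
    -- again.
    have m2 := hc e r s hrs hr hs (by rw [h.root_eq_zero.1]; omega)
    rw [h.root_eq_zero.2, zero_add] at m2
    have := S.add_mem m1 m2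
    have heq : η + Pi.single e 1 + p s + (p s + Pi.single e 1) = η := by
      have : η + Pi.single e 1 + p s + (p s + Pi.single e 1) =
        η + (Pi.single e 1 + Pi.single e 1) + (p s + p s) := by abel
      rw [this, add_self_vec, add_self_vec, add_zero, add_zero]
    rwa [heq] at this

end DualGraph

/-! ## Greedy bases modulo a subspace -/

section GreedyBasis

set_option linter.unusedSectionVars false

variable {E : Type*} [Fintype E]

/-- The state of the greedy algorithm at weight `w`: the vectors `ν 0, …, ν (g - 1)` of `Z` have
been chosen, in ascending order of weight; they are independent modulo `B` and generate everything
in `Z` of weight less than `w`. -/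
structure IsGreedy (Z B : Submodule (ZMod 2) (E → ZMod 2)) (w g : ℕ) (ν : ℕ → E → ZMod 2) :
    Prop where
  mem : ∀ j < g, ν j ∈ Z
  sorted : ∀ i j, i ≤ j → j < g → wt (ν i) ≤ wt (ν j)
  wt_le : ∀ j < g, wt (ν j) ≤ w
  indep : ∀ i < g, ν i ∉ B ⊔ Submodule.span (ZMod 2) (ν '' {j | j < i})
  spans : ∀ η ∈ Z, wt η < w →
    η ∈ B ⊔ Submodule.span (ZMod 2) (ν '' {j | j < g ∧ wt (ν j) ≤ wt η})

variable {Z B : Submodule (ZMod 2) (E → ZMod 2)} {w g : ℕ} {ν ν' : ℕ → E → ZMod 2}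

lemma sup_span_mono {M : Type*} [AddCommGroup M] [Module (ZMod 2) M] {B : Submodule (ZMod 2) M}
    {S T : Set M} (h : S ⊆ T) :
    B ⊔ Submodule.span (ZMod 2) S ≤ B ⊔ Submodule.span (ZMod 2) T :=
  sup_le_sup le_rfl (Submodule.span_mono h)

lemma IsGreedy.zero : IsGreedy Z B 0 0 ν :=
  ⟨by simp, by simp, by simp, by simp, by simp⟩

lemma image_lt_congr (h : ∀ j < g, ν' j = ν j) : ν' '' {j | j < g} = ν '' {j | j < g} :=
  Set.image_congr h

lemma image_lt_succ : ν '' {j | j < g + 1} = insert (ν g) (ν '' {j | j < g}) := by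
  have : {j | j < g + 1} = insert g {j | j < g} := by
    ext j; simp only [Set.mem_ofPred_eq, Set.mem_insert_iff]; omega
  rw [this, Set.image_insert_eq]

lemma IsGreedy.congr (h : IsGreedy Z B w g ν) (hν : ∀ j < g, ν' j = ν j) :
    IsGreedy Z B w g ν' := by
  refine ⟨fun j hj => hν j hj ▸ h.mem j hj, fun i j hij hj => ?_,
    fun j hj => hν j hj ▸ h.wt_le j hj, fun i hi => ?_, fun η hη hw => ?_⟩
  · rw [hν i (by omega), hν j hj]
    exact h.sorted i j hij hj
  · rw [hν i hi, image_lt_congr fun j hj => hν j (lt_trans hj hi)]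
    exact h.indep i hi
  · refine sup_span_mono ?_ (h.spans η hη hw)
    rintro _ ⟨j, ⟨hj, hjw⟩, rfl⟩
    exact ⟨j, ⟨hj, (hν j hj).symm ▸ hjw⟩, hν j hj⟩

/-- An independent vector has weight exactly `w`, since everything lighter in `Z` is already
generated. This keeps the list sorted although `w` only bounds the weight of the vector. -/
lemma IsGreedy.append (h : IsGreedy Z B w g ν) (hZ : ν g ∈ Z) (hw : wt (ν g) ≤ w)
    (hS : ν g ∉ B ⊔ Submodule.span (ZMod 2) (ν '' {j | j < g})) : IsGreedy Z B w (g + 1) ν := by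
  have hwt : wt (ν g) = w := by
    by_contra hne
    refine hS (sup_span_mono ?_ (h.spans _ hZ (by omega)))
    exact Set.image_mono fun j hj => hj.1
  refine ⟨fun j hj => ?_, fun i j hij hj => ?_, fun j hj => ?_, fun i hi => ?_, fun η hη hw' => ?_⟩
  · rcases Nat.lt_succ_iff_lt_or_eq.1 hj with hj | rfl
    · exact h.mem j hj
    · exact hZ
  · rcases Nat.lt_succ_iff_lt_or_eq.1 hj with hj | rfl
    · exact h.sorted i j hij hj
    · rcases Nat.lt_or_eq_of_le hij with hi | rfl
      · exact hwt.symm ▸ h.wt_le i hi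
      · exact le_rfl
  · rcases Nat.lt_succ_iff_lt_or_eq.1 hj with hj | rfl
    · exact h.wt_le j hj
    · exact hw
  · rcases Nat.lt_succ_iff_lt_or_eq.1 hi with hi | rfl
    · exact h.indep i hi
    · exact hS
  · refine sup_span_mono ?_ (h.spans η hη hw')
    exact Set.image_mono fun j hj => ⟨Nat.lt_succ_of_lt hj.1, hj.2⟩

lemma IsGreedy.next (h : IsGreedy Z B w g ν)
    (hS : ∀ η ∈ Z, wt η ≤ w → η ∈ B ⊔ Submodule.span (ZMod 2) (ν '' {j | j < g})) :
    IsGreedy Z B (w + 1) g ν := by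
  refine ⟨h.mem, h.sorted, fun j hj => (h.wt_le j hj).trans (Nat.le_succ w), h.indep,
    fun η hη hw => ?_⟩
  rcases Nat.lt_succ_iff_lt_or_eq.1 hw with hw | hw
  · exact h.spans η hη hw
  · refine sup_span_mono ?_ (hS η hη hw.le)
    exact Set.image_mono fun j hj => ⟨hj, hw ▸ h.wt_le j hj⟩

lemma linearIndependent_of_notMem_span_lt {M : Type*} [AddCommGroup M] [Module (ZMod 2) M] :
    ∀ {n : ℕ} {v : Fin n → M}, (∀ i, v i ∉ Submodule.span (ZMod 2) (v '' {j | j < i})) →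
      LinearIndependent (ZMod 2) v
  | 0, _, _ => linearIndependent_empty_type
  | n + 1, v, h => by
    rw [linearIndependent_finSucc']
    refine ⟨linearIndependent_of_notMem_span_lt fun i hi => h i.castSucc ?_, fun hl => h (Fin.last n) ?_⟩
    · refine Submodule.span_mono ?_ hi
      rintro _ ⟨j, hj, rfl⟩
      exact ⟨j.castSucc, hj, rfl⟩
    · refine Submodule.span_mono ?_ hl
      rintro _ ⟨j, rfl⟩
      exact ⟨j.castSucc, Fin.castSucc_lt_last j, rfl⟩

end GreedyBasis

/-! ## Echelon forms -/

section EchelonForm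

variable {m : ℕ}

/-- The row `G i` is zero or has its first nonzero coordinate at `i`. -/
structure IsEchelon (G : Fin m → Fin m → ZMod 2) : Prop where
  low : ∀ i j, j < i → G i j = 0
  zero : ∀ i, G i i = 0 → G i = 0

/-- Forward substitution: in a combination equal to `v`, coordinate `k < i` sees only row `k`,
because earlier terms already vanish and later rows start later; so term `k` vanishes too. Then no
term is left to produce `v i`. -/
lemma IsEchelon.notMem_span {G : Fin m → Fin m → ZMod 2} (hG : IsEchelon G) {v : Fin m → ZMod 2}
    {i : Fin m} (hv : ∀ j < i, v j = 0) (hvi : v i ≠ 0) (hi : G i i = 0) :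
    v ∉ Submodule.span (ZMod 2) (Set.range G) := by
  intro h
  obtain ⟨c, rfl⟩ := (Submodule.mem_span_range_iff_exists_fun _).1 h
  have hc : ∀ k : Fin m, k < i → c k • G k = 0 := by
    intro k
    induction k using WellFoundedLT.induction with
    | _ k ih =>
    intro hk
    have := hv k hk
    rw [Finset.sum_apply, Finset.sum_eq_single k] at this
    · rcases mul_eq_zero.1 this with h | h
      · rw [h, zero_smul]
      · rw [hG.zero k h, smul_zero]
    · intro l _ hl
      rcases lt_or_gt_of_ne hl with hl | hl
      · rw [ih l hl (hl.trans hk)]; rfl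
      · simp [hG.low l k hl]
    · simp
  apply hvi
  rw [Finset.sum_apply]
  refine Finset.sum_eq_zero fun l _ => ?_
  rcases lt_trichotomy l i with hl | rfl | hl
  · rw [hc l hl]; rfl
  · simp [hi]
  · simp [hG.low l i hl]

lemma IsEchelon.update {G : Fin m → Fin m → ZMod 2} (hG : IsEchelon G) {v : Fin m → ZMod 2}
    {i : Fin m} (hv : ∀ j < i, v j = 0) (hvi : v i ≠ 0) : IsEchelon (Function.update G i v) := by
  constructor
  · intro k j hj
    by_cases hk : k = i
    · subst hk; simpa using hv j hj
    · simpa [hk] using hG.low k j hj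
  · intro k hk
    by_cases hki : k = i
    · subst hki; simp [hvi] at hk
    · simp only [ne_eq, hki, not_false_eq_true, Function.update_of_ne] at hk ⊢
      exact hG.zero k hk

lemma span_update_of_eq_zero {G : Fin m → Fin m → ZMod 2} {v : Fin m → ZMod 2} {i : Fin m}
    (hi : G i = 0) : Submodule.span (ZMod 2) (Set.range (Function.update G i v)) =
      Submodule.span (ZMod 2) (Set.range G) ⊔ Submodule.span (ZMod 2) {v} := by
  apply le_antisymm
  · rw [Submodule.span_le]
    rintro _ ⟨k, rfl⟩
    by_cases hk : k = i
    · subst hk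
      rw [Function.update_self]
      exact Submodule.mem_sup_right (Submodule.mem_span_singleton_self v)
    · rw [Function.update_of_ne hk]
      exact Submodule.mem_sup_left (Submodule.subset_span ⟨k, rfl⟩)
  · rw [sup_le_iff, Submodule.span_le, Submodule.span_le, Set.singleton_subset_iff]
    refine ⟨?_, Submodule.subset_span ⟨i, by simp⟩⟩
    rintro _ ⟨k, rfl⟩
    by_cases hk : k = i
    · subst hk; rw [hi]; exact Submodule.zero_mem _
    · exact Submodule.subset_span ⟨k, by simp [hk]⟩

end EchelonForm

end THS

namespace THS

/-! ## Row operations -/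

section Rows

/-- The absolute difference; on bits, the exclusive or. -/
def Expr.dist (a b : Expr) : Expr := .add (.sub a b) (.sub b a)

/-- The entry in column `j` of row `i` of the matrix in bank `b`; bank 6 holds the offsets of
the rows. -/
def Expr.entry (b : ℕ) (i j : Expr) : Expr := .load b (.add (.load 6 i) j)

@[simp] lemma Expr.dist_eval (a b : Expr) (s : State) :
    (Expr.dist a b).eval s = (a.eval s - b.eval s) + (b.eval s - a.eval s) := rfl

@[simp] lemma Expr.entry_eval (b : ℕ) (i j : Expr) (s : State) :
    (Expr.entry b i j).eval s = s.mem b (s.mem 6 (i.eval s) + j.eval s) := rfl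

lemma val_xor (a b : ZMod 2) : (a.val - b.val) + (b.val - a.val) = (a + b).val := by
  revert a b; decide

/-- The machine cannot multiply; on bits, truncation turns the count of zeros into a conjunction. -/
lemma val_and (a b : ZMod 2) : 1 - ((1 - a.val) + (1 - b.val)) = (a * b).val := by
  revert a b; decide

lemma val_ne_zero {a : ZMod 2} : a.val ≠ 0 ↔ a ≠ 0 := by
  revert a; decide

lemma val_single {m : ℕ} (e j : Fin m) : 1 - (((j : ℕ) - e) + ((e : ℕ) - j)) =
    ((Pi.single e 1 : Fin m → ZMod 2) j).val := by
  by_cases h : j = e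
  · subst h; simp [ZMod.val_one]
  · have : (j : ℕ) ≠ e := fun h' => h (Fin.ext h')
    simp only [h, Pi.single_apply, if_false, ZMod.val_zero]
    omega

/-- The cells of `M` from `x` on hold the vector `v`. -/
def IsRow {m : ℕ} (M : ℕ → ℕ) (x : ℕ) (v : Fin m → ZMod 2) : Prop :=
  ∀ j : Fin m, M (x + j) = (v j).val

/-- The array `M` holds the rows of the matrix `G`, one after the other. -/
def IsMat {k m : ℕ} (M : ℕ → ℕ) (G : Fin k → Fin m → ZMod 2) : Prop :=
  ∀ i : Fin k, IsRow M (i * m) (G i)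

lemma row_disjoint {m i k j : ℕ} (h : k ≠ i) (hj : j < m) :
    k * m + j < i * m ∨ i * m + m ≤ k * m + j := by
  rcases lt_or_gt_of_ne h with h | h
  · left
    have := Nat.mul_le_mul_right m (Nat.succ_le_of_lt h)
    rw [Nat.succ_mul] at this
    omega
  · right
    have := Nat.mul_le_mul_right m (Nat.succ_le_of_lt h)
    rw [Nat.succ_mul] at this
    omega

lemma IsMat.update {k m : ℕ} {M M' : ℕ → ℕ} {G : Fin k → Fin m → ZMod 2} (h : IsMat M G)
    {i : Fin k} {v : Fin m → ZMod 2} (hv : IsRow M' (i * m) v)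
    (hM : ∀ y, y < i * m ∨ i * m + m ≤ y → M' y = M y) : IsMat M' (Function.update G i v) := by
  intro k j
  by_cases hk : k = i
  · subst hk; simpa using hv j
  · rw [Function.update_of_ne hk, hM _ (row_disjoint (fun h => hk (Fin.ext h)) j.2)]
    exact h k j

namespace Cmd

/-- Fill the cells of bank `b` from `x` on, as many as register 1 says, with the values of `e` for
the column index in register 3. -/
def fill (b : ℕ) (x e : Expr) : Cmd := .loop 3 (.reg 1) (.store b (.add x (.reg 3)) e)

/-- The expressions are evaluated anew in every round, so the hypotheses concern intermediate
states. That the cells from `a + k` on are still old allows `e` to read the row being overwritten,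
as the elimination does. -/
lemma run_fill {m : ℕ} {b : ℕ} {x e : Expr} {s : State} (hm : s.reg 1 = m) (a : ℕ)
    (v : Fin m → ZMod 2) (hx : ∀ s', (fill b x e).Frame s s' → x.eval s' = a)
    (he : ∀ s', (fill b x e).Frame s s' → ∀ k : Fin m, s'.reg 3 = k →
      (∀ y, y < a ∨ a + k ≤ y → s'.mem b y = s.mem b y) → e.eval s' = (v k).val) :
    IsRow (((fill b x e).run s).mem b) a v ∧
      ∀ y, y < a ∨ a + m ≤ y → ((fill b x e).run s).mem b y = s.mem b y := by
  have := (run_loop (s := s) (i := 3) (b := .reg 1) (c := .store b (.add x (.reg 3)) e)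
    (fun k s' => (∀ j : Fin m, (j : ℕ) < k → s'.mem b (a + j) = (v j).val) ∧
      ∀ y, y < a ∨ a + k ≤ y → s'.mem b y = s.mem b y) ⟨by simp, by simp⟩ ?_).1
  · rw [Expr.eval, hm] at this
    exact ⟨fun j => this.1 j j.2, this.2⟩
  · intro k hk s' hF h3 hI
    rw [Expr.eval, hm] at hk
    have h1 := hx s' hF
    have h2 := he s' hF ⟨k, hk⟩ h3 hI.2
    simp only [run, Expr.eval, State.setReg_mem, State.setMem_mem, h1, h2, h3, true_and]
    refine ⟨fun j hj => ?_, fun y hy => ?_⟩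
    · by_cases hjk : (j : ℕ) = k
      · rw [if_pos (by omega)]
        congr 2
        exact Fin.ext hjk.symm
      · rw [if_neg (by omega)]
        exact hI.1 j (by omega)
    · rw [if_neg (by omega)]
      exact hI.2 y (by omega)

end Cmd

/-- The registers and banks that are not changed after the preprocessing: the numbers of edges and
faces, the offsets of the rows, and the incidence matrix. -/
structure Env {m f : ℕ} (inc : Fin f → Fin m → Prop) (s : State) : Prop where
  edges : s.reg 1 = m
  faces : s.reg 2 = f
  offset : ∀ i ≤ m + f, s.mem 6 i = i * m
  inc : ∀ (a : Fin f) (e : Fin m), s.mem 7 (a * m + e) ≠ 0 ↔ inc a e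

variable {m f : ℕ} {inc : Fin f → Fin m → Prop}

lemma Env.frame {s s' : State} (h : Env inc s) {c : Cmd} (hF : c.Frame s s')
    (hc : 1 ∉ c.regs ∧ 2 ∉ c.regs ∧ 6 ∉ c.banks ∧ 7 ∉ c.banks) : Env inc s' := by
  refine ⟨?_, ?_, ?_, ?_⟩
  · rw [hF.1 _ hc.1, h.edges]
  · rw [hF.1 _ hc.2.1, h.faces]
  · rw [hF.2 _ hc.2.2.1]; exact h.offset
  · rw [hF.2 _ hc.2.2.2]; exact h.inc

lemma Env.setReg {s : State} (h : Env inc s) {x a : ℕ} (hx : 3 ≤ x) : Env inc (s.setReg x a) := by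
  refine ⟨?_, ?_, h.offset, h.inc⟩
  · rw [State.setReg_reg, if_neg (by omega), h.edges]
  · rw [State.setReg_reg, if_neg (by omega), h.faces]

end Rows

namespace Cmd

/-! ## Gaussian elimination -/

section Insert

/-- Clear column `i` (register 4) of the vector in bank 9 by row `i` of the matrix in bank 8; if
that row is zero, move the vector there. -/
def reduceStep : Cmd :=
  .cond (.load 9 (.reg 4))
    (.cond (.entry 8 (.reg 4) (.reg 4))
      (fill 9 (.const 0) (.dist (.load 9 (.reg 3)) (.entry 8 (.reg 4) (.reg 3))))
      (.seq (fill 8 (.load 6 (.reg 4)) (.load 9 (.reg 3)))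
        -- With bank 9 cleared, the remaining columns do nothing.
        (.seq (fill 9 (.const 0) (.const 0)) (.assign 5 (.const 1)))))
    .skip

/-- Insert the vector in bank 9 into the echelon form in bank 8; register 5 tells whether it was
independent of the rows. -/
def insert : Cmd := .seq (.assign 5 (.const 0)) (.loop 4 (.reg 1) reduceStep)

variable {m f : ℕ} {inc : Fin f → Fin m → Prop}

lemma run_reduceStep {s : State} (hE : Env inc s) {k : Fin m} (hk : s.reg 4 = k)
    {v : Fin m → ZMod 2} (hv : IsRow (s.mem 9) 0 v) {G : Fin m → Fin m → ZMod 2}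
    (hG : IsMat (s.mem 8) G) :
    (v k ≠ 0 → G k k ≠ 0 → IsRow ((reduceStep.run s).mem 9) 0 (v + G k) ∧
      (reduceStep.run s).mem 8 = s.mem 8 ∧ (reduceStep.run s).reg 5 = s.reg 5) ∧
    (v k ≠ 0 → G k k = 0 → IsRow ((reduceStep.run s).mem 9) 0 (0 : Fin m → ZMod 2) ∧
      IsMat ((reduceStep.run s).mem 8) (Function.update G k v) ∧
      (reduceStep.run s).reg 5 = 1) := by
  have hoff : s.mem 6 k = k * m := hE.offset k (by omega)
  have h1 : s.mem 9 k = (v k).val := by simpa using hv k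
  have h2 : s.mem 8 (k * m + k) = (G k k).val := hG k k
  refine ⟨fun h0 hGk => ?_, fun h0 hGk => ?_⟩
  · have hrun : reduceStep.run s = (fill 9 (.const 0)
        (.dist (.load 9 (.reg 3)) (.entry 8 (.reg 4) (.reg 3)))).run s := by
      rw [reduceStep, run, if_pos, run, if_pos]
      · simp only [Expr.entry_eval, Expr.eval, hk, hoff, h2]; exact val_ne_zero.2 hGk
      · simp only [Expr.eval, hk, h1]; exact val_ne_zero.2 h0
    rw [hrun]
    refine ⟨(run_fill hE.edges 0 (v + G k) (fun _ _ => rfl) ?_).1, run_mem _ (by decide) _,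
      run_reg _ (by decide) _⟩
    intro s' hF j h3 hb
    simp only [Expr.dist_eval, Expr.entry_eval, Expr.eval, h3, hF.1 4 (by decide), hk,
      hF.2 6 (by decide), hF.2 8 (by decide), hoff, hb j (by omega)]
    have := hv j
    rw [zero_add] at this
    rw [this, hG k j, val_xor]
    rfl
  · set s₁ := (fill 8 (.load 6 (.reg 4)) (.load 9 (.reg 3))).run s with hs₁
    set s₂ := (fill 9 (.const 0) (.const 0)).run s₁ with hs₂
    have hrun : reduceStep.run s = s₂.setReg 5 1 := by
      rw [reduceStep, run, if_pos, run, if_neg]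
      · rfl
      · simp only [Expr.entry_eval, Expr.eval, hk, hoff, h2, hGk]; simp
      · simp only [Expr.eval, hk, h1]; exact val_ne_zero.2 h0
    have e1 := run_fill (b := 8) (x := .load 6 (.reg 4)) (e := .load 9 (.reg 3)) hE.edges (k * m) v
      (fun s' hF => by
        simp only [Expr.eval, hF.1 4 (by decide), hF.2 6 (by decide), hk, hoff])
      (fun s' hF j h3 _ => by
        have := hv j
        rw [zero_add] at this
        simp only [Expr.eval, h3, hF.2 9 (by decide), this])
    rw [← hs₁] at e1
    have hm₁ : s₁.reg 1 = m := (run_reg _ (by decide) _).trans hE.edges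
    have e2 := run_fill (b := 9) (x := .const 0) (e := .const 0) hm₁ 0 (0 : Fin m → ZMod 2)
      (fun _ _ => rfl) (fun s' hF j h3 _ => by simp [Expr.eval])
    have h8 : s₂.mem 8 = s₁.mem 8 := run_mem _ (by decide) _
    rw [hrun]
    refine ⟨e2.1, ?_, by simp⟩
    rw [State.setReg_mem, h8]
    exact hG.update e1.1 e1.2

theorem run_insert {s : State} (hE : Env inc s) {v : Fin m → ZMod 2}
    (hv : IsRow (s.mem 9) 0 v) {G : Fin m → Fin m → ZMod 2} (hG : IsMat (s.mem 8) G)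
    (hech : IsEchelon G) :
    ∃ G' : Fin m → Fin m → ZMod 2, IsMat ((insert.run s).mem 8) G' ∧ IsEchelon G' ∧
      Submodule.span (ZMod 2) (Set.range G') =
        Submodule.span (ZMod 2) (Set.range G) ⊔ Submodule.span (ZMod 2) {v} ∧
      ((insert.run s).reg 5 ≠ 0 ↔ v ∉ Submodule.span (ZMod 2) (Set.range G)) := by
  have hE' : Env inc (s.setReg 5 0) := hE.setReg (by omega)
  -- The remainder `v'` vanishes in the first `k` columns. Either nothing has been stored and `v`
  -- agrees with `v'` modulo the rows, or the remainder was stored as a new row and is now 0. After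
  -- all columns `v' = 0`, so the flag decides membership.
  have := (run_loop (s := s.setReg 5 0) (i := 4) (b := .reg 1) (c := reduceStep)
    (fun k s' => ∃ v' : Fin m → ZMod 2, IsRow (s'.mem 9) 0 v' ∧ (∀ j : Fin m, (j : ℕ) < k → v' j = 0) ∧
      ((s'.reg 5 = 0 ∧ IsMat (s'.mem 8) G ∧ v + v' ∈ Submodule.span (ZMod 2) (Set.range G)) ∨
      (s'.reg 5 = 1 ∧ v' = 0 ∧ v ∉ Submodule.span (ZMod 2) (Set.range G) ∧
        ∃ G' : Fin m → Fin m → ZMod 2, IsMat (s'.mem 8) G' ∧ IsEchelon G' ∧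
        Submodule.span (ZMod 2) (Set.range G') =
          Submodule.span (ZMod 2) (Set.range G) ⊔ Submodule.span (ZMod 2) {v})))
    ⟨v, hv, by simp, Or.inl ⟨by simp, hG, by rw [add_self_vec]; exact Submodule.zero_mem _⟩⟩ ?_).1
  · rw [Expr.eval, hE'.edges] at this
    obtain ⟨v', hv', hlow, hI⟩ := this
    obtain rfl : v' = 0 := funext fun j => hlow j j.2
    rcases hI with ⟨h5, hM, hmem⟩ | ⟨h5, -, hmem, G', hM, hech', hspan⟩
    · rw [add_zero] at hmem
      refine ⟨G, hM, hech, ?_, ?_⟩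
      · rw [left_eq_sup, Submodule.span_le]
        exact Set.singleton_subset_iff.2 hmem
      · exact ⟨fun h => absurd h5 h, fun h => absurd hmem h⟩
    · refine ⟨G', hM, hech', hspan, fun _ => hmem, fun _ => ?_⟩
      exact ne_of_eq_of_ne h5 one_ne_zero
  · intro k hk s' hF h4 ⟨v', hv', hlow, hI⟩
    have hEs' : Env inc s' := hE'.frame hF (by decide)
    rw [Expr.eval, hE'.edges] at hk
    simp only [State.setReg_mem, State.setReg_reg, if_neg (show (5 : ℕ) ≠ 4 by decide)]
    have hsucc : ∀ {u : Fin m → ZMod 2}, (∀ j : Fin m, (j : ℕ) < k → u j = 0) → u ⟨k, hk⟩ = 0 →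
        ∀ j : Fin m, (j : ℕ) < k + 1 → u j = 0 := by
      intro u h1 h2 j hj
      rcases Nat.lt_succ_iff_lt_or_eq.1 hj with hj | hj
      · exact h1 j hj
      · rwa [show j = ⟨k, hk⟩ from Fin.ext hj]
    by_cases h0 : v' ⟨k, hk⟩ = 0
    · refine ⟨v', ?_⟩
      have hstep : reduceStep.run s' = s' := by
        simp only [reduceStep, run, Expr.eval, h4]
        have := hv' ⟨k, hk⟩
        rw [zero_add] at this
        rw [if_neg]
        simp [this, h0]
      rw [hstep]
      exact ⟨hv', hsucc hlow h0, hI⟩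
    rcases hI with ⟨h5, hM, hmem⟩ | ⟨h5, rfl, -⟩
    swap
    · exact absurd rfl h0
    obtain ⟨hs1, hs2⟩ := run_reduceStep hEs' (k := ⟨k, hk⟩) h4 hv' hM
    by_cases hGk : G ⟨k, hk⟩ ⟨k, hk⟩ = 0
    · obtain ⟨hr, hM', h5'⟩ := hs2 h0 hGk
      have hlow' : ∀ j < (⟨k, hk⟩ : Fin m), v' j = 0 := fun j hj => hlow j hj
      have hv'mem := hech.notMem_span hlow' h0 hGk
      -- The stored row is `v'` rather than `v`; the two differ by an element of the span of the
      -- rows, so they enlarge it equally.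
      have hspan := span_update_of_eq_zero (v := v') (hech.zero _ hGk)
      refine ⟨0, hr, fun _ _ => rfl, Or.inr ⟨h5', rfl, fun hmv => hv'mem ?_, _, hM',
        hech.update hlow' h0, hspan.trans ?_⟩⟩
      · have := Submodule.add_mem _ hmem hmv
        rwa [add_comm v v', add_add_cancel_vec] at this
      · apply le_antisymm <;> refine sup_le le_sup_left ?_ <;>
          rw [Submodule.span_le, Set.singleton_subset_iff]
        · have := Submodule.add_mem _ (Submodule.mem_sup_left (T := Submodule.span (ZMod 2) {v}) hmem)
            (Submodule.mem_sup_right (Submodule.mem_span_singleton_self v))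
          rwa [add_comm v v', add_add_cancel_vec] at this
        · have := Submodule.add_mem _ (Submodule.mem_sup_left (T := Submodule.span (ZMod 2) {v'}) hmem)
            (Submodule.mem_sup_right (Submodule.mem_span_singleton_self v'))
          rwa [add_add_cancel_vec] at this
    · obtain ⟨hr, hM', h5'⟩ := hs1 h0 hGk
      rw [hM', h5']
      refine ⟨_, hr, hsucc (fun j hj => ?_) ?_, Or.inl ⟨h5, hM, ?_⟩⟩
      · rw [Pi.add_apply, hlow j hj, hech.low _ _ hj, add_zero]
      · rw [Pi.add_apply, zmod_two_eq_one h0, zmod_two_eq_one hGk]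
        rfl
      · rw [← add_assoc]
        exact Submodule.add_mem _ hmem (Submodule.subset_span ⟨_, rfl⟩)

end Insert

end Cmd

end THS

namespace THS

namespace Cmd

/-! ## Loops over an edge and two faces -/

section Triples

/-- Run `c` for every edge (register 9) and every pair of faces (registers 10 and 11). -/
def forTriples (c : Cmd) : Cmd :=
  .loop 9 (.reg 1) (.loop 10 (.reg 2) (.loop 11 (.reg 2) c))

variable {m f : ℕ}

/-- Indexing the invariant by the set of visited triples hides the nesting: a user proves one step,
which adds one triple, and obtains the invariant for all triples. -/
theorem run_forTriples {c : Cmd} (hc : 1 ∉ c.regs ∧ 2 ∉ c.regs ∧ 9 ∉ c.regs ∧ 10 ∉ c.regs)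
    (J : Set (Fin m × Fin f × Fin f) → State → Prop)
    (hset : ∀ D s x a, 9 ≤ x → x ≤ 11 → J D s → J D (s.setReg x a))
    (hstep : ∀ D s, ∀ (e : Fin m) (a b : Fin f), s.reg 9 = (e : ℕ) → s.reg 10 = (a : ℕ) → s.reg 11 = (b : ℕ) →
      J D s → J (D ∪ {(e, a, b)}) (c.run s))
    {s : State} (hm : s.reg 1 = m) (hf : s.reg 2 = f) (h : J ∅ s) :
    J Set.univ ((forTriples c).run s) := by
  obtain ⟨h1, h2, h9, h10⟩ := hc
  have inner : ∀ D s, ∀ (e : Fin m) (a : Fin f), s.reg 2 = f → s.reg 9 = (e : ℕ) → s.reg 10 = (a : ℕ) →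
      J D s → J (D ∪ {t | t.1 = e ∧ t.2.1 = a}) ((loop 11 (.reg 2) c).run s) := by
    intro D s e a hf he ha hJ
    have := (run_loop (s := s) (i := 11) (b := .reg 2) (c := c)
      (fun k s' => J (D ∪ {t | t.1 = e ∧ t.2.1 = a ∧ (t.2.2 : ℕ) < k}) s') ?_ ?_).1
    · rw [Expr.eval, hf] at this
      simpa using this
    · simpa using hset _ _ 11 0 (by omega) (by omega) hJ
    · intro k hk s' hF h11 hI
      rw [Expr.eval, hf] at hk
      have := hstep _ s' e a ⟨k, hk⟩ ((hF.1 9 (by simp [regs, h9])).trans he)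
        ((hF.1 10 (by simp [regs, h10])).trans ha) h11 hI
      refine (congrArg (J · _) ?_).mp (hset _ _ 11 (k + 1) (by omega) (by omega) this)
      ext ⟨x, y, z⟩
      simp only [Set.mem_union, Set.mem_ofPred_eq, Set.mem_singleton_iff, Prod.mk.injEq,
        Fin.ext_iff]
      by_cases hD : (x, y, z) ∈ D <;> simp only [hD, true_or, false_or]
      omega
  have middle : ∀ D s, ∀ (e : Fin m), s.reg 2 = f → s.reg 9 = (e : ℕ) →
      J D s → J (D ∪ {t | t.1 = e}) ((loop 10 (.reg 2) (loop 11 (.reg 2) c)).run s) := by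
    intro D s e hf he hJ
    have := (run_loop (s := s) (i := 10) (b := .reg 2) (c := loop 11 (.reg 2) c)
      (fun k s' => J (D ∪ {t | t.1 = e ∧ (t.2.1 : ℕ) < k}) s') ?_ ?_).1
    · rw [Expr.eval, hf] at this
      simpa using this
    · simpa using hset _ _ 10 0 (by omega) (by omega) hJ
    · intro k hk s' hF h10' hI
      rw [Expr.eval, hf] at hk
      have := inner _ s' e ⟨k, hk⟩ ((hF.1 2 (by simp [regs, h2])).trans hf)
        ((hF.1 9 (by simp [regs, h9])).trans he) h10' hI
      refine (congrArg (J · _) ?_).mp (hset _ _ 10 (k + 1) (by omega) (by omega) this)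
      ext ⟨x, y, z⟩
      simp only [Set.mem_union, Set.mem_ofPred_eq, Fin.ext_iff]
      by_cases hD : (x, y, z) ∈ D <;> simp only [hD, true_or, false_or]
      omega
  rw [forTriples]
  have := (run_loop (s := s) (i := 9) (b := .reg 1) (c := loop 10 (.reg 2) (loop 11 (.reg 2) c))
    (fun k s' => J {t | (t.1 : ℕ) < k} s') ?_ ?_).1
  · rw [Expr.eval, hm] at this
    simpa using this
  · simpa using hset _ _ 9 0 (by omega) (by omega) h
  · intro k hk s' hF h9' hI
    rw [Expr.eval, hm] at hk
    have := middle _ s' ⟨k, hk⟩ ((hF.1 2 (by simp [regs, h2])).trans hf) h9' hI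
    refine (congrArg (J · _) ?_).mp (hset _ _ 9 (k + 1) (by omega) (by omega) this)
    ext ⟨x, y, z⟩
    simp only [Set.mem_union, Set.mem_ofPred_eq, Fin.ext_iff]
    omega

end Triples

/-! ## Shortest paths -/

section ShortestPaths

/-- Set all distances to infinity and all path chains to 0, and the distance of the root
(register 7) to 0. -/
def initPaths : Cmd :=
  -- No chain weighs more than the number of edges, so that number plus 1 serves as infinity.
  .seq (.loop 10 (.reg 2) (.seq (.store 10 (.reg 10) (.add (.reg 1) (.const 1)))
      (fill 11 (.load 6 (.reg 10)) (.const 0))))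
    (.store 10 (.reg 7) (.const 0))

/-- Improve the path to the second face by passing from the first face through the edge. -/
def relax : Cmd :=
  .cond (.entry 7 (.reg 10) (.reg 9)) (.cond (.entry 7 (.reg 11) (.reg 9))
    (.cond (.sub (.load 10 (.reg 11)) (.add (.load 10 (.reg 10)) (.const 1)))
      (.seq (.store 10 (.reg 11) (.add (.load 10 (.reg 10)) (.const 1)))
        (fill 11 (.load 6 (.reg 11)) (.dist (.entry 11 (.reg 10) (.reg 3))
          (.sub (.const 1) (.dist (.reg 3) (.reg 9))))))
      .skip) .skip) .skip

/-- Compute shortest path chains from the face in register 7: distances into bank 10, chains into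
bank 11. -/
def shortestPaths : Cmd := .seq initPaths (.loop 8 (.reg 1) (forTriples relax))

variable {m f : ℕ} {inc : Fin f → Fin m → Prop} {r : Fin f}

/-- The state holds the distances `d` and the chains `p`, which belong to paths from `r`. -/
structure Paths (inc : Fin f → Fin m → Prop) (r : Fin f) (d : Fin f → ℕ)
    (p : Fin f → Fin m → ZMod 2) (s : State) : Prop where
  dist : ∀ u : Fin f, s.mem 10 u = d u
  chain : IsMat (s.mem 11) p
  bdry : ∀ u, d u ≤ m → dualBdry inc (p u) = Pi.single r 1 + Pi.single u 1
  wt_le : ∀ u, d u ≤ m → wt (p u) ≤ d u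

lemma run_initPaths {s : State} (hE : Env inc s) (hr : s.reg 7 = r) :
    Paths inc r (fun u => if u = r then 0 else m + 1) 0 (initPaths.run s) := by
  set s₁ := (Cmd.loop 10 (.reg 2) (.seq (.store 10 (.reg 10) (.add (.reg 1) (.const 1)))
      (fill 11 (.load 6 (.reg 10)) (.const 0)))).run s with hs₁
  have h7 : s₁.reg 7 = r := (run_reg _ (by decide) s).trans hr
  have key : (∀ u : Fin f, s₁.mem 10 u = m + 1) ∧
      IsMat (s₁.mem 11) (0 : Fin f → Fin m → ZMod 2) := by
    have := (run_loop (s := s) (i := 10) (b := .reg 2) (c := .seq (.store 10 (.reg 10) (.add (.reg 1) (.const 1)))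
      (fill 11 (.load 6 (.reg 10)) (.const 0)))
      (fun k s' => (∀ u : Fin f, (u : ℕ) < k → s'.mem 10 u = m + 1) ∧
        ∀ u : Fin f, (u : ℕ) < k → IsRow (s'.mem 11) (u * m) (0 : Fin m → ZMod 2))
      ⟨by simp, by simp⟩ ?_).1
    · rw [Expr.eval, hE.faces] at this
      rw [hs₁]
      exact ⟨fun u => this.1 u u.2, fun u => this.2 u u.2⟩
    · intro k hk s' hF h10 hI
      have hE' : Env inc s' := hE.frame hF (by decide)
      rw [Expr.eval, hE.faces] at hk
      set s₂ := (Cmd.store 10 (.reg 10) (.add (.reg 1) (.const 1))).run s' with hs₂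
      have hE₂ : Env inc s₂ := hE'.frame (frame _ _) (by decide)
      have h10₂ : s₂.reg 10 = k := h10
      have e := run_fill (b := 11) (x := .load 6 (.reg 10)) (e := .const 0) hE₂.edges (k * m)
        (0 : Fin m → ZMod 2) (fun t hF => by
          simp only [Expr.eval, hF.1 10 (by decide), hF.2 6 (by decide), h10₂]
          exact hE₂.offset k (by omega))
        (fun t hF j h3 _ => by simp [Expr.eval])
      have hm10 : ((fill 11 (.load 6 (.reg 10)) (.const 0)).run s₂).mem 10 = s₂.mem 10 :=
        run_mem _ (by decide) _
      rw [run, ← hs₂]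
      simp only [State.setReg_mem]
      constructor
      · intro u hu
        rw [hm10, hs₂]
        simp only [run, Expr.eval, State.setMem_mem, h10, hE'.edges, true_and]
        split_ifs with h
        · rfl
        · exact hI.1 u (by omega)
      · intro u hu j
        by_cases huk : (u : ℕ) = k
        · rw [huk]; exact e.1 j
        · rw [e.2 _ (row_disjoint huk j.2)]
          exact hI.2 u (by omega) j
  have hrun : initPaths.run s = s₁.setMem 10 r 0 := by
    rw [initPaths, run, ← hs₁, run]
    simp [Expr.eval, h7]
  rw [hrun]
  refine ⟨fun u => ?_, ?_, fun u hu => ?_, fun u hu => ?_⟩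
  · simp only [State.setMem_mem, true_and, Fin.ext_iff]
    split_ifs
    · rfl
    · exact key.1 u
  · intro u j
    simpa using key.2 u j
  · split_ifs at hu with h
    · subst h; simp [add_self_vec]
    · omega
  · rw [Pi.zero_apply, wt_eq_zero.2 rfl]
    exact Nat.zero_le _

lemma run_relax (h2 : TwoFaces inc) {s : State} (hE : Env inc s) {e : Fin m} {a b : Fin f}
    (he : s.reg 9 = e) (ha : s.reg 10 = a) (hb : s.reg 11 = b) {d : Fin f → ℕ}
    {p : Fin f → Fin m → ZMod 2} (h : Paths inc r d p s) :
    ∃ d' p', Paths inc r d' p' (relax.run s) ∧ d' ≤ d ∧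
      (inc a e → inc b e → d' b ≤ d a + 1) := by
  have hoa : s.mem 6 a = a * m := hE.offset a (by omega)
  have hob : s.mem 6 b = b * m := hE.offset b (by omega)
  have hia := hE.inc a e
  have hib := hE.inc b e
  rw [relax, run]
  simp only [Expr.entry_eval, Expr.eval, he, ha, hoa]
  split_ifs with hca
  swap
  · exact ⟨d, p, h, le_rfl, fun hi => absurd (hia.2 hi) hca⟩
  rw [run]
  simp only [Expr.entry_eval, Expr.eval, he, hb, hob]
  split_ifs with hcb
  swap
  · exact ⟨d, p, h, le_rfl, fun _ hi => absurd (hib.2 hi) hcb⟩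
  rw [run]
  simp only [Expr.eval, ha, hb, h.dist]
  split_ifs with hcd
  swap
  · exact ⟨d, p, h, le_rfl, fun _ _ => by omega⟩
  -- The strict improvement just tested is impossible for `a = b`.
  have hab : a ≠ b := by rintro rfl; omega
  set s₂ := (Cmd.store 10 (.reg 11) (.add (.load 10 (.reg 10)) (.const 1))).run s with hs₂
  have hE₂ : Env inc s₂ := hE.frame (frame _ _) (by decide)
  have e1 := run_fill (b := 11) (x := .load 6 (.reg 11)) (e := .dist (.entry 11 (.reg 10) (.reg 3))
    (.sub (.const 1) (.dist (.reg 3) (.reg 9)))) hE₂.edges (b * m) (p a + Pi.single e 1)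
    (fun t hF => by
      simp only [Expr.eval, hF.1 11 (by decide), hF.2 6 (by decide)]
      change s.mem 6 (s.reg 11) = _
      rw [hb, hob])
    (fun t hF j h3 hold => by
      have e10 : t.reg 10 = a := (hF.1 10 (by decide)).trans ha
      have e9 : t.reg 9 = e := (hF.1 9 (by decide)).trans he
      have e6 : t.mem 6 a = a * m := (congrFun (hF.2 6 (by decide)) a).trans hoa
      -- Row `a` is read while row `b` is written; the rows are disjoint because `a ≠ b`.
      have e11 : t.mem 11 (a * m + j) = (p a j).val := by
        rw [hold]
        · exact h.chain a j
        · have := row_disjoint (m := m) (i := b) (k := a) (j := j) (fun h => hab (Fin.ext h)) j.2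
          have := j.2
          rcases lt_or_gt_of_ne (fun h => hab (Fin.ext h) : (a : ℕ) ≠ b) with hlt | hlt
          · omega
          · have := Nat.mul_le_mul_right m (Nat.succ_le_of_lt hlt)
            rw [Nat.succ_mul] at this
            omega
      simp only [Expr.dist_eval, Expr.entry_eval, Expr.eval, h3, e10, e9, e6, e11, val_single,
        val_xor]
      rfl)
  have hm10 : ((fill 11 (.load 6 (.reg 11)) (.dist (.entry 11 (.reg 10) (.reg 3))
    (.sub (.const 1) (.dist (.reg 3) (.reg 9))))).run s₂).mem 10 = s₂.mem 10 :=
    run_mem _ (by decide) _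
  rw [run, ← hs₂]
  refine ⟨Function.update d b (d a + 1), Function.update p b (p a + Pi.single e 1),
    ⟨fun u => ?_, ?_, fun u hu => ?_, fun u hu => ?_⟩, ?_, fun _ _ => by simp⟩
  · rw [hm10, hs₂]
    simp only [run, Expr.eval, State.setMem_mem, ha, hb, h.dist, true_and]
    by_cases hu : u = b
    · subst hu; simp
    · rw [if_neg (fun h => hu (Fin.ext h)), Function.update_of_ne hu]
  · exact IsMat.update (M := s₂.mem 11) h.chain e1.1 e1.2
  · by_cases hub : u = b
    · subst hub
      rw [Function.update_self] at hu ⊢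
      rw [map_add, h.bdry a (by omega), dualBdry_single h2 hab (hia.1 hca) (hib.1 hcb),
        ← add_assoc, add_add_cancel_vec]
    · rw [Function.update_of_ne hub] at hu ⊢
      exact h.bdry u hu
  · by_cases hub : u = b
    · subst hub
      rw [Function.update_self] at hu ⊢
      rw [Function.update_self]
      have h1 := wt_add_le (p a) (Pi.single e 1)
      have h2 := h.wt_le a (by omega)
      rw [wt_single] at h1
      omega
    · rw [Function.update_of_ne hub] at hu ⊢
      rw [Function.update_of_ne hub]
      exact h.wt_le u hu
  · intro u
    by_cases hub : u = b
    · subst hub; rw [Function.update_self]; change d a + 1 ≤ d u; omega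
    · rw [Function.update_of_ne hub]

/-- The distances `d` are right for chains of weight at most `k`. -/
def RightUpTo (inc : Fin f → Fin m → Prop) (r : Fin f) (k : ℕ) (d : Fin f → ℕ) : Prop :=
  ∀ u θ, dualBdry inc θ = Pi.single r 1 + Pi.single u 1 → wt θ ≤ k → d u ≤ wt θ

/-- The Bellman–Ford step: cut off an edge of `θ` at `u`; the old distances are right for the
shorter chain, and the relaxed edge restores the missing 1. -/
lemma RightUpTo.succ (h2 : TwoFaces inc) {k : ℕ} {d d' : Fin f → ℕ} (h : RightUpTo inc r k d)
    (hle : d' ≤ d) (hd : ∀ e a b, inc a e → inc b e → d' b ≤ d a + 1) :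
    RightUpTo inc r (k + 1) d' := by
  intro u θ hθ hw
  by_cases hur : u = r
  · subst hur
    have h0 := h u 0 (by rw [map_zero, add_self_vec]) (by rw [wt_eq_zero.2 rfl]; omega)
    rw [wt_eq_zero.2 rfl] at h0
    exact (hle u).trans (h0.trans (Nat.zero_le _))
  · obtain ⟨e, he, hne⟩ := exists_edge_of_dualBdry_ne_zero (inc := inc) (θ := θ) (u := u)
      (by rw [hθ]; simp [hur])
    obtain ⟨u', huu', he'⟩ := h2.exists_other he
    have hwt := wt_add_single hne
    have h1 := h u' (θ + Pi.single e 1) (by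
      rw [map_add, hθ, dualBdry_single h2 huu' he he', ← add_assoc, add_add_cancel_vec]) (by omega)
    have := hd e u' u he' he
    omega

theorem run_shortestPaths (h2 : TwoFaces inc) {s : State} (hE : Env inc s) (hr : s.reg 7 = r) :
    ∃ d p, IsShortest inc r d p ∧ (∀ u : Fin f, (shortestPaths.run s).mem 10 u = d u) ∧
      IsMat ((shortestPaths.run s).mem 11) p := by
  have hE₁ : Env inc (initPaths.run s) := hE.frame (frame _ _) (by decide)
  have hsetPaths : ∀ {s x a d p}, Paths inc r d p s → Paths inc r d p (s.setReg x a) :=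
    fun h => ⟨h.dist, h.chain, h.bdry, h.wt_le⟩
  have := (run_loop (s := initPaths.run s) (i := 8) (b := .reg 1) (c := forTriples relax)
    (fun k s' => ∃ d p, Paths inc r d p s' ∧ RightUpTo inc r k d)
    ⟨_, _, hsetPaths (run_initPaths hE hr), ?_⟩ ?_).1
  · rw [Expr.eval, hE₁.edges] at this
    obtain ⟨d, p, hP, hR⟩ := this
    refine ⟨d, p, ⟨?_, ?_, fun u θ hθ => hR u θ hθ ?_⟩, hP.dist, hP.chain⟩
    · rw [Fintype.card_fin]; exact hP.bdry
    · rw [Fintype.card_fin]; exact hP.wt_le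
    · exact (wt_le_card θ).trans_eq (Fintype.card_fin m)
  · intro u θ hθ hw
    obtain rfl := wt_eq_zero.1 (Nat.le_zero.1 hw)
    rw [map_zero] at hθ
    by_cases hu : u = r
    · simp [hu]
    · have := congrFun hθ u
      simp [hu] at this
  · rintro k - s' hF - ⟨d₀, p₀, hP, hR⟩
    have hE' : Env inc s' := hE₁.frame hF (by decide)
    -- Distances only decrease within a round, so the inequality against the distances `d₀` at its
    -- beginning survives for every visited triple.
    obtain ⟨-, d, p, hP', hle, hd⟩ := run_forTriples (m := m) (f := f) (c := relax) (by decide)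
      (fun D s => Env inc s ∧ ∃ d p, Paths inc r d p s ∧ d ≤ d₀ ∧
        ∀ t ∈ D, inc t.2.1 t.1 → inc t.2.2 t.1 → d t.2.2 ≤ d₀ t.2.1 + 1)
      (fun D s x a h9 _ ⟨hE, d, p, hP, h⟩ => ⟨hE.setReg (by omega), d, p, hsetPaths hP, h⟩)
      (fun D s e a b he ha hb ⟨hE, d, p, hP, hle, hD⟩ => by
        obtain ⟨d', p', hP', hle', hd'⟩ := run_relax h2 hE he ha hb hP
        refine ⟨hE.frame (frame _ _) (by decide), d', p', hP', hle'.trans hle, ?_⟩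
        rintro t (ht | rfl) h1 h2
        · exact (hle' _).trans (hD t ht h1 h2)
        · exact (hd' h1 h2).trans (Nat.succ_le_succ (hle a)))
      hE'.edges hE'.faces ⟨hE', d₀, p₀, hP, le_rfl, by simp⟩
    exact ⟨d, p, hsetPaths hP', hR.succ h2 hle fun e a b h1 h2 => hd (e, a, b) trivial h1 h2⟩

end ShortestPaths

end Cmd

end THS

namespace THS

namespace Cmd

/-! ## The greedy algorithm -/

section Greedy

open Matrix in
/-- Register 14 tells whether a chosen vector has pairing 1 with `ζ`; if so, register 15 holds the
index of the first one, and bank 1 the vector itself. -/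
def Found {m : ℕ} (ζ : Fin m → ZMod 2) (g : ℕ) (ν : ℕ → Fin m → ZMod 2) (s : State) : Prop :=
  (s.reg 14 = 0 ∧ ∀ j < g, ν j ⬝ᵥ ζ = 0) ∨
    (s.reg 14 ≠ 0 ∧ s.reg 15 < g ∧ ν (s.reg 15) ⬝ᵥ ζ = 1 ∧ (∀ j < s.reg 15, ν j ⬝ᵥ ζ = 0) ∧
      IsRow (s.mem 1) 0 (ν (s.reg 15)))

/-- Register 16 := the pairing of the vector in bank 12 with the vector in bank 5. -/
def pairing : Cmd :=
  .seq (.assign 16 (.const 0)) (.loop 3 (.reg 1) (.assign 16 (.dist (.reg 16)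
    (.sub (.const 1) (.add (.sub (.const 1) (.load 12 (.reg 3)))
      (.sub (.const 1) (.load 5 (.reg 3))))))))

/-- Record the vector in bank 12, which has the index in register 12, if it is the first one that
has pairing 1 with the vector in bank 5. -/
def checkPairing : Cmd :=
  .cond (.reg 14) .skip (.seq pairing (.cond (.reg 16)
    (.seq (.assign 15 (.reg 12)) (.seq (.assign 14 (.const 1))
      (fill 1 (.const 0) (.load 12 (.reg 3))))) .skip))

/-- Append the vector in bank 12 to the list of chosen vectors. -/
def accept : Cmd :=
  .seq (fill 0 (.reg 13) (.load 12 (.reg 3))) (.seq checkPairing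
    (.seq (.assign 13 (.add (.reg 13) (.reg 1))) (.assign 12 (.add (.reg 12) (.const 1)))))

/-- Offer the candidate of the edge and the faces in the registers 9, 10, 11. -/
def offer : Cmd :=
  .seq (fill 9 (.const 0) (.dist (.dist (.entry 11 (.reg 10) (.reg 3))
      (.entry 11 (.reg 11) (.reg 3))) (.sub (.const 1) (.dist (.reg 3) (.reg 9)))))
    (.seq (fill 12 (.const 0) (.load 9 (.reg 3))) (.seq insert (.cond (.reg 5) accept .skip)))

/-- Offer the candidate of the edge and the faces in the registers 9, 10, 11 if the faces are the
two faces at the edge and the weight bound is at most the number in register 6. -/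
def tryOffer : Cmd :=
  .cond (.entry 7 (.reg 10) (.reg 9)) (.cond (.entry 7 (.reg 11) (.reg 9))
    (.cond (.dist (.reg 10) (.reg 11))
      (.cond (.sub (.add (.add (.load 10 (.reg 10)) (.load 10 (.reg 11))) (.const 1)) (.reg 6))
        .skip offer) .skip) .skip) .skip

/-- The greedy algorithm. -/
def greedy : Cmd :=
  .loop 6 (.add (.reg 1) (.const 1)) (.loop 7 (.reg 2) (.seq shortestPaths (forTriples tryOffer)))

variable {m f : ℕ} {inc : Fin f → Fin m → Prop} {ζ : Fin m → ZMod 2} {g w : ℕ}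
  {ν : ℕ → Fin m → ZMod 2} {B : Submodule (ZMod 2) (Fin m → ZMod 2)}

open Matrix in
lemma run_pairing {s : State} (hm : s.reg 1 = m) {c : Fin m → ZMod 2} (hc : IsRow (s.mem 12) 0 c)
    (hζ : IsRow (s.mem 5) 0 ζ) : (pairing.run s).reg 16 = (c ⬝ᵥ ζ).val := by
  have := (run_loop (s := s.setReg 16 0) (i := 3) (b := .reg 1) (c := .assign 16 (.dist (.reg 16)
      (.sub (.const 1) (.add (.sub (.const 1) (.load 12 (.reg 3)))
        (.sub (.const 1) (.load 5 (.reg 3)))))))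
    (fun k s' => s'.reg 16 = ((Finset.univ.filter fun i : Fin m => (i : ℕ) < k).sum fun i => c i * ζ i).val) (by simp) ?_).1
  · have h1 : Expr.eval (s.setReg 16 0) (.reg 1) = m := by simpa [Expr.eval] using hm
    rw [h1, Finset.filter_true_of_mem fun i _ => i.2] at this
    exact this
  · intro k hk s' hF h3 hI
    have h1 : Expr.eval (s.setReg 16 0) (.reg 1) = m := by simpa [Expr.eval] using hm
    rw [h1] at hk
    have h12 := hc ⟨k, hk⟩
    have h5 := hζ ⟨k, hk⟩
    rw [zero_add] at h12 h5
    have hset : (Finset.univ.filter fun i : Fin m => (i : ℕ) < k + 1) =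
        Insert.insert (⟨k, hk⟩ : Fin m) (Finset.univ.filter fun i : Fin m => (i : ℕ) < k) := by
      ext i
      simp only [Finset.mem_filter, Finset.mem_univ, true_and, Finset.mem_insert, Fin.ext_iff]
      omega
    rw [hset, Finset.sum_insert (by simp), add_comm]
    simp only [run, Expr.dist_eval, Expr.eval, State.setReg_reg, h3, hF.2 12 (by decide),
      hF.2 5 (by decide), State.setReg_mem, h12, h5, hI, val_and, val_xor]
    rw [if_neg (by decide), if_pos trivial, add_comm]

lemma run_checkPairing {s : State} (hm : s.reg 1 = m) (hg : s.reg 12 = g)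
    (hc : IsRow (s.mem 12) 0 (ν g)) (hζ : IsRow (s.mem 5) 0 ζ) (h : Found ζ g ν s) :
    Found ζ (g + 1) ν (checkPairing.run s) := by
  rcases h with ⟨h14, h0⟩ | ⟨h14, h15, h1, hlt, hrow⟩
  · rw [checkPairing, run_cond_neg (show (Expr.reg 14).eval s = 0 from h14), run]
    have hp := run_pairing hm hc hζ
    by_cases hd : ν g ⬝ᵥ ζ = 0
    · rw [run_cond_neg (by rw [Expr.eval, hp, hd, ZMod.val_zero])]
      refine Or.inl ⟨(run_reg pairing (by decide) s).trans h14, fun j hj => ?_⟩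
      rcases Nat.lt_succ_iff_lt_or_eq.1 hj with hj | rfl
      · exact h0 j hj
      · exact hd
    · rw [run_cond_pos (by rw [Expr.eval, hp]; exact val_ne_zero.2 hd)]
      set s₁ := ((pairing.run s).setReg 15 g).setReg 14 1 with hs₁
      have h12 : (pairing.run s).reg 12 = g := (run_reg _ (by decide) _).trans hg
      have hrun : (Cmd.seq (.assign 15 (.reg 12)) (.seq (.assign 14 (.const 1))
          (fill 1 (.const 0) (.load 12 (.reg 3))))).run (pairing.run s) =
          (fill 1 (.const 0) (.load 12 (.reg 3))).run s₁ := by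
        simp only [run, Expr.eval, h12, hs₁]
      rw [hrun]
      have hm₁ : s₁.reg 1 = m := by
        simp only [hs₁, State.setReg_reg]
        exact (run_reg _ (by decide) _).trans hm
      have hc₁ : IsRow (s₁.mem 12) 0 (ν g) := by
        have : s₁.mem 12 = s.mem 12 := run_mem _ (by decide) _
        rwa [this]
      have e := run_fill (b := 1) (x := .const 0) (e := .load 12 (.reg 3)) hm₁ 0 (ν g)
        (fun _ _ => rfl) (fun t hF j h3 _ => by
          have := hc₁ j
          rw [zero_add] at this
          simp only [Expr.eval, h3, hF.2 12 (by decide), this])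
      have h15 : ((fill 1 (.const 0) (.load 12 (.reg 3))).run s₁).reg 15 = g :=
        (run_reg _ (by decide) _).trans (by simp [hs₁])
      have h14' : ((fill 1 (.const 0) (.load 12 (.reg 3))).run s₁).reg 14 = 1 :=
        (run_reg _ (by decide) _).trans (by simp [hs₁])
      refine Or.inr ⟨?_, ?_, ?_, ?_, ?_⟩
      · rw [h14']; exact one_ne_zero
      · rw [h15]; exact Nat.lt_succ_self g
      · rw [h15]; exact zmod_two_eq_one hd
      · rw [h15]; exact h0
      · rw [h15]; exact e.1
  · rw [checkPairing, run_cond_pos (show (Expr.reg 14).eval s ≠ 0 from h14)]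
    exact Or.inr ⟨h14, h15.trans (Nat.lt_succ_self g), h1, hlt, hrow⟩

/-- The invariant of the greedy algorithm. -/
structure Main (inc : Fin f → Fin m → Prop) (B : Submodule (ZMod 2) (Fin m → ZMod 2))
    (ζ : Fin m → ZMod 2) (w g : ℕ) (ν : ℕ → Fin m → ZMod 2) (s : State) : Prop where
  env : Env inc s
  isGreedy : IsGreedy (LinearMap.ker (dualBdry inc)) B w g ν
  echelon : ∃ G : Fin m → Fin m → ZMod 2, IsMat (s.mem 8) G ∧ IsEchelon G ∧
    Submodule.span (ZMod 2) (Set.range G) = B ⊔ Submodule.span (ZMod 2) (ν '' {j | j < g})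
  count : s.reg 12 = g
  offset : s.reg 13 = g * m
  out : ∀ j < g, IsRow (s.mem 0) (j * m) (ν j)
  zeta : IsRow (s.mem 5) 0 ζ
  found : Found ζ g ν s

lemma Main.frame {s s' : State} (h : Main inc B ζ w g ν s) {c : Cmd} (hF : c.Frame s s')
    (hr : 1 ∉ c.regs ∧ 2 ∉ c.regs ∧ 12 ∉ c.regs ∧ 13 ∉ c.regs ∧ 14 ∉ c.regs ∧ 15 ∉ c.regs)
    (hb : 0 ∉ c.banks ∧ 1 ∉ c.banks ∧ 5 ∉ c.banks ∧ 6 ∉ c.banks ∧ 7 ∉ c.banks ∧ 8 ∉ c.banks) :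
    Main inc B ζ w g ν s' := by
  obtain ⟨r1, r2, r12, r13, r14, r15⟩ := hr
  obtain ⟨b0, b1, b5, b6, b7, b8⟩ := hb
  refine ⟨h.env.frame hF ⟨r1, r2, b6, b7⟩, h.isGreedy, ?_, ?_, ?_, ?_, ?_, ?_⟩
  · rw [hF.2 _ b8]; exact h.echelon
  · rw [hF.1 _ r12]; exact h.count
  · rw [hF.1 _ r13]; exact h.offset
  · rw [hF.2 _ b0]; exact h.out
  · rw [hF.2 _ b5]; exact h.zeta
  · rw [Found, hF.1 _ r14, hF.1 _ r15, hF.2 _ b1]; exact h.found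

lemma Main.setReg {s : State} (h : Main inc B ζ w g ν s) {x a : ℕ} (h3 : 3 ≤ x) (h11 : x ≤ 11) :
    Main inc B ζ w g ν (s.setReg x a) := by
  have : ∀ y, 12 ≤ y → (s.setReg x a).reg y = s.reg y := fun y hy => by
    rw [State.setReg_reg, if_neg (by omega)]
  refine ⟨h.env.setReg h3, h.isGreedy, h.echelon, ?_, ?_, h.out, h.zeta, ?_⟩
  · rw [this _ (by omega)]; exact h.count
  · rw [this _ (by omega)]; exact h.offset
  · rw [Found, this _ (by omega), this _ (by omega)]; exact h.found

/-- The state at entry is mixed: the echelon form already contains `ν g`, while the list, the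
counters and `Found` still stop before it. -/
lemma run_accept {s : State} (hE : Env inc s)
    (hgr : IsGreedy (LinearMap.ker (dualBdry inc)) B w (g + 1) ν)
    (hech : ∃ G : Fin m → Fin m → ZMod 2, IsMat (s.mem 8) G ∧ IsEchelon G ∧
      Submodule.span (ZMod 2) (Set.range G) =
        B ⊔ Submodule.span (ZMod 2) (ν '' {j | j < g + 1}))
    (hg : s.reg 12 = g) (hoff : s.reg 13 = g * m) (hout : ∀ j < g, IsRow (s.mem 0) (j * m) (ν j))
    (hζ : IsRow (s.mem 5) 0 ζ) (hfound : Found ζ g ν s) (hc : IsRow (s.mem 12) 0 (ν g)) :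
    Main inc B ζ w (g + 1) ν (accept.run s) := by
  set s₁ := (fill 0 (.reg 13) (.load 12 (.reg 3))).run s with hs₁
  set s₂ := checkPairing.run s₁ with hs₂
  have F₁ : Frame _ s s₁ := frame _ s
  have F₂ : Frame _ s₁ s₂ := frame _ s₁
  have hE₂ : Env inc s₂ := (hE.frame F₁ (by decide)).frame F₂ (by decide)
  have hrun : accept.run s = (s₂.setReg 13 (s₂.reg 13 + s₂.reg 1)).setReg 12 (s₂.reg 12 + 1) := by
    rw [accept, run, run, ← hs₁, ← hs₂]
    simp [run, Expr.eval]
  have h12 : s₂.reg 12 = g := by rw [F₂.1 _ (by decide), F₁.1 _ (by decide), hg]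
  have h13 : s₂.reg 13 = g * m := by rw [F₂.1 _ (by decide), F₁.1 _ (by decide), hoff]
  have e := run_fill (b := 0) (x := .reg 13) (e := .load 12 (.reg 3)) hE.edges (g * m) (ν g)
    (fun t hF => by simp only [Expr.eval, hF.1 13 (by decide), hoff])
    (fun t hF j h3 _ => by
      have := hc j
      rw [zero_add] at this
      simp only [Expr.eval, h3, hF.2 12 (by decide), this])
  rw [← hs₁] at e
  have hf₂ : Found ζ (g + 1) ν s₂ := by
    refine run_checkPairing ?_ ?_ ?_ ?_ ?_
    · rw [F₁.1 _ (by decide), hE.edges]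
    · rw [F₁.1 _ (by decide), hg]
    · rw [F₁.2 _ (by decide)]; exact hc
    · rw [F₁.2 _ (by decide)]; exact hζ
    · rw [Found, F₁.1 14 (by decide), F₁.1 15 (by decide), F₁.2 1 (by decide)]; exact hfound
  rw [hrun]
  refine ⟨(hE₂.setReg (by omega)).setReg (by omega), hgr, ?_, ?_, ?_, ?_, ?_, ?_⟩
  · simp only [State.setReg_mem]
    rw [F₂.2 _ (by decide), F₁.2 _ (by decide)]; exact hech
  · simp [h12]
  · simp [h13, hE₂.edges, Nat.succ_mul]
  · intro j hj
    simp only [State.setReg_mem]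
    rw [F₂.2 _ (by decide)]
    rcases Nat.lt_succ_iff_lt_or_eq.1 hj with hj | rfl
    · intro i
      rw [e.2 _ (row_disjoint hj.ne i.2)]
      exact hout j hj i
    · exact e.1
  · simp only [State.setReg_mem]
    rw [F₂.2 _ (by decide), F₁.2 _ (by decide)]; exact hζ
  · simpa [Found] using hf₂

/-- Accepted or not, the candidate is generated afterwards, and earlier choices stay. Bank 12 keeps
a copy because `insert` destroys the vector in bank 9. -/
lemma run_offer {s : State} (h : Main inc B ζ w g ν s) {e : Fin m} {a b : Fin f}
    (he : s.reg 9 = e) (ha : s.reg 10 = a) (hb : s.reg 11 = b) {p : Fin f → Fin m → ZMod 2}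
    (hp : IsMat (s.mem 11) p) (hZ : dualBdry inc (p a + p b + Pi.single e 1) = 0)
    (hw : wt (p a + p b + Pi.single e 1) ≤ w) :
    ∃ g' ν', Main inc B ζ w g' ν' (offer.run s) ∧ g ≤ g' ∧ (∀ j < g, ν' j = ν j) ∧
      p a + p b + Pi.single e 1 ∈ B ⊔ Submodule.span (ZMod 2) (ν' '' {j | j < g'}) := by
  have hoa : s.mem 6 a = a * m := h.env.offset a (by omega)
  have hob : s.mem 6 b = b * m := h.env.offset b (by omega)
  set v := p a + p b + Pi.single e 1 with hv
  set s₁ := (fill 9 (.const 0) (.dist (.dist (.entry 11 (.reg 10) (.reg 3))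
      (.entry 11 (.reg 11) (.reg 3))) (.sub (.const 1) (.dist (.reg 3) (.reg 9))))).run s with hs₁
  set s₂ := (fill 12 (.const 0) (.load 9 (.reg 3))).run s₁ with hs₂
  have F₁ : Frame _ s s₁ := frame _ s
  have F₂ : Frame _ s₁ s₂ := frame _ s₁
  have M₁ : Main inc B ζ w g ν s₁ := h.frame F₁ (by decide) (by decide)
  have M₂ : Main inc B ζ w g ν s₂ := M₁.frame F₂ (by decide) (by decide)
  have e₁ : IsRow (s₁.mem 9) 0 v := (run_fill (b := 9) (x := .const 0) h.env.edges 0 v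
    (fun _ _ => rfl) (fun t hF j h3 _ => by
      simp only [Expr.dist_eval, Expr.entry_eval, Expr.eval, h3, hF.1 9 (by decide),
        hF.1 10 (by decide), hF.1 11 (by decide), he, ha, hb, hF.2 6 (by decide), hoa, hob,
        hF.2 11 (by decide), hp a j, hp b j, val_single, val_xor]
      rfl)).1
  have e₂ : IsRow (s₂.mem 12) 0 v := (run_fill (b := 12) (x := .const 0) M₁.env.edges 0 v
    (fun _ _ => rfl) (fun t hF j h3 _ => by
      have := e₁ j
      rw [zero_add] at this
      simp only [Expr.eval, h3, hF.2 9 (by decide), this])).1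
  have e₃ : IsRow (s₂.mem 9) 0 v := by rw [F₂.2 _ (by decide)]; exact e₁
  obtain ⟨G, hG, hech, hspan⟩ := M₂.echelon
  obtain ⟨G', hG', hech', hspan', h5⟩ := run_insert M₂.env e₃ hG hech
  set s₃ := insert.run s₂ with hs₃
  have F₃ : Frame _ s₂ s₃ := frame _ s₂
  have hrun : offer.run s = if s₃.reg 5 ≠ 0 then accept.run s₃ else s₃ := rfl
  have hfound : Found ζ g ν s₃ := by
    rw [Found, F₃.1 14 (by decide), F₃.1 15 (by decide), F₃.2 1 (by decide)]; exact M₂.found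
  have hE₃ : Env inc s₃ := M₂.env.frame F₃ (by decide)
  have h12 : s₃.reg 12 = g := (F₃.1 _ (by decide)).trans M₂.count
  have h13 : s₃.reg 13 = g * m := (F₃.1 _ (by decide)).trans M₂.offset
  have hout : ∀ j < g, IsRow (s₃.mem 0) (j * m) (ν j) := by
    rw [F₃.2 0 (by decide)]; exact M₂.out
  have hζ : IsRow (s₃.mem 5) 0 ζ := by rw [F₃.2 5 (by decide)]; exact M₂.zeta
  rw [hrun]
  rw [hspan] at h5 hspan'
  by_cases hmem : v ∈ B ⊔ Submodule.span (ZMod 2) (ν '' {j | j < g})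
  · rw [if_neg fun h => h5.1 h hmem]
    refine ⟨g, ν, ⟨hE₃, M₂.isGreedy, ⟨G', hG', hech', ?_⟩, h12, h13, hout, hζ, hfound⟩, le_rfl,
      fun _ _ => rfl, hmem⟩
    rw [hspan', sup_eq_left, Submodule.span_le, Set.singleton_subset_iff]
    exact hmem
  · rw [if_pos (h5.2 hmem)]
    have hν : ∀ j < g, Function.update ν g v j = ν j := fun j hj =>
      Function.update_of_ne hj.ne _ _
    have hspan₁ : B ⊔ Submodule.span (ZMod 2) (Function.update ν g v '' {j | j < g + 1}) =
        B ⊔ Submodule.span (ZMod 2) (ν '' {j | j < g}) ⊔ Submodule.span (ZMod 2) {v} := by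
      rw [image_lt_succ, image_lt_congr hν, Function.update_self, Submodule.span_insert, sup_assoc,
        sup_comm (Submodule.span (ZMod 2) {v})]
    refine ⟨g + 1, Function.update ν g v, run_accept hE₃ ?_ ⟨G', hG', hech', ?_⟩ h12 h13 ?_ hζ ?_ ?_,
      Nat.le_succ g, hν, ?_⟩
    · refine (M₂.isGreedy.congr hν).append ?_ ?_ ?_
      · rw [Function.update_self]; exact hZ
      · rw [Function.update_self]; exact hw
      · rw [Function.update_self, image_lt_congr hν]; exact hmem
    · rw [hspan', hspan₁]
    · intro j hj
      rw [hν j hj]; exact hout j hj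
    · rcases hfound with ⟨h14, h0⟩ | ⟨h14, h15, h1, hlt, hrow⟩
      · exact Or.inl ⟨h14, fun j hj => by rw [hν j hj]; exact h0 j hj⟩
      · refine Or.inr ⟨h14, h15, ?_, fun j hj => ?_, ?_⟩
        · rw [hν _ h15]; exact h1
        · rw [hν j (hj.trans h15)]; exact hlt j hj
        · rw [hν _ h15]; exact hrow
    · rw [Function.update_self, F₃.2 12 (by decide)]; exact e₂
    · rw [hspan₁]
      exact Submodule.mem_sup_right (Submodule.mem_span_singleton_self v)

theorem run_greedy (h2 : TwoFaces inc) {s : State} (h : Main inc B ζ 0 0 ν s) :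
    ∃ g ν, Main inc B ζ (m + 1) g ν (greedy.run s) := by
  have hm : Expr.eval s (.add (.reg 1) (.const 1)) = m + 1 := by simp [Expr.eval, h.env.edges]
  have := (run_loop (s := s) (i := 6) (b := .add (.reg 1) (.const 1))
    (c := .loop 7 (.reg 2) (.seq shortestPaths (forTriples tryOffer)))
    (fun w s' => ∃ g ν, Main inc B ζ w g ν s')
    ⟨_, _, h.setReg (by omega) (by omega)⟩ ?_).1
  · rwa [hm] at this
  rintro w hw s' - h6 ⟨g, ν, hI⟩
  -- All candidates of root `r` within the weight bound are generated. Once this holds for every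
  -- root, all cycles of weight at most `w` are generated and `w` can advance.
  let Q : ℕ → (ℕ → Fin m → ZMod 2) → Fin f → Prop := fun g ν r =>
    ∃ d p, IsShortest inc r d p ∧ ∀ e a b, a ≠ b → inc a e → inc b e → d a + d b + 1 ≤ w →
      p a + p b + Pi.single e 1 ∈ B ⊔ Submodule.span (ZMod 2) (ν '' {j | j < g})
  rw [hm] at hw
  have hround := (run_loop (s := s') (i := 7) (b := .reg 2)
    (c := .seq shortestPaths (forTriples tryOffer))
    (fun k t => t.reg 6 = w ∧ ∃ g ν, Main inc B ζ w g ν t ∧ ∀ r : Fin f, (r : ℕ) < k → Q g ν r)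
    ⟨h6, g, ν, hI.setReg (by omega) (by omega), by simp⟩ ?_).1
  · rw [Expr.eval, hI.env.faces] at hround
    obtain ⟨-, g', ν', hM, hQ⟩ := hround
    refine ⟨g', ν', Main.setReg ?_ (by omega) (by omega)⟩
    refine { hM with isGreedy := hM.isGreedy.next fun η hη hηw => ?_ }
    exact mem_of_shortest_candidates h2 (fun r => hQ r r.2) hη hηw
  rintro k hk t - h7 ⟨h6t, g, ν, hM, hQ⟩
  rw [Expr.eval, hI.env.faces] at hk
  obtain ⟨d, p, hS, hd, hp⟩ := run_shortestPaths h2 hM.env (r := ⟨k, hk⟩) h7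
  have F : Frame _ t (shortestPaths.run t) := frame _ t
  have hM' := hM.frame F (by decide) (by decide)
  -- Choices are only appended, so what was generated for earlier roots and triples remains
  -- generated.
  have mono : ∀ {g g' : ℕ} {ν ν' : ℕ → Fin m → ZMod 2}, g ≤ g' → (∀ j < g, ν' j = ν j) →
      B ⊔ Submodule.span (ZMod 2) (ν '' {j | j < g}) ≤
        B ⊔ Submodule.span (ZMod 2) (ν' '' {j | j < g'}) := fun hg hν => by
    rw [← image_lt_congr hν]
    exact sup_span_mono (Set.image_mono fun j hj => lt_of_lt_of_le hj hg)
  have hT := run_forTriples (m := m) (f := f) (c := tryOffer)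
    (by decide)
    (fun D t' => t'.reg 6 = w ∧ (∀ u : Fin f, t'.mem 10 u = d u) ∧ IsMat (t'.mem 11) p ∧
      ∃ g' ν', Main inc B ζ w g' ν' t' ∧ g ≤ g' ∧ (∀ j < g, ν' j = ν j) ∧
        ∀ x ∈ D, x.2.1 ≠ x.2.2 → inc x.2.1 x.1 → inc x.2.2 x.1 → d x.2.1 + d x.2.2 + 1 ≤ w →
          p x.2.1 + p x.2.2 + Pi.single x.1 1 ∈
            B ⊔ Submodule.span (ZMod 2) (ν' '' {j | j < g'}))
    (fun D t' x a h9 h11 ⟨h6, hd, hp, g', ν', hM, h⟩ =>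
      ⟨by rw [State.setReg_reg, if_neg (by omega), h6], hd, hp, g', ν',
        hM.setReg (by omega) h11, h⟩)
    ?_ hM'.env.edges hM'.env.faces
    ⟨(F.1 _ (by decide)).trans h6t, hd, hp, g, ν, hM', le_rfl, fun _ _ => rfl, by simp⟩
  · obtain ⟨h6', -, -, g', ν', hM₁, hg, hν, hD⟩ := hT
    refine ⟨by simpa [run] using h6', g', ν', hM₁.setReg (by omega) (by omega), fun r hr => ?_⟩
    by_cases hrk : (r : ℕ) = k
    · obtain rfl : r = ⟨k, hk⟩ := Fin.ext hrk
      exact ⟨d, p, hS, fun e a b => hD (e, a, b) trivial⟩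
    · obtain ⟨d', p', hS', h'⟩ := hQ r (by omega)
      exact ⟨d', p', hS', fun e a b h1 h2 h3 h4 => mono hg hν (h' e a b h1 h2 h3 h4)⟩
  rintro D t' e a b he ha hb ⟨h6, hd, hp, g', ν', hM, hg, hν, hD⟩
  have hoa : t'.mem 6 a = a * m := hM.env.offset a (by omega)
  have hob : t'.mem 6 b = b * m := hM.env.offset b (by omega)
  have ea : (Expr.entry 7 (.reg 10) (.reg 9)).eval t' ≠ 0 ↔ inc a e := by
    simp only [Expr.entry_eval, Expr.eval, he, ha, hoa]
    exact hM.env.inc a e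
  have eb : (Expr.entry 7 (.reg 11) (.reg 9)).eval t' ≠ 0 ↔ inc b e := by
    simp only [Expr.entry_eval, Expr.eval, he, hb, hob]
    exact hM.env.inc b e
  have eab : (Expr.dist (.reg 10) (.reg 11)).eval t' ≠ 0 ↔ a ≠ b := by
    simp only [Expr.dist_eval, Expr.eval, ha, hb, ne_eq, Fin.ext_iff]
    omega
  have ew : (Expr.sub (.add (.add (.load 10 (.reg 10)) (.load 10 (.reg 11))) (.const 1))
      (.reg 6)).eval t' = 0 ↔ d a + d b + 1 ≤ w := by
    simp only [Expr.eval, ha, hb, hd, h6]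
    omega
  by_cases hc : a ≠ b ∧ inc a e ∧ inc b e ∧ d a + d b + 1 ≤ w
  · obtain ⟨hab, hia, hib, hdw⟩ := hc
    have hrun : tryOffer.run t' = offer.run t' := by
      rw [tryOffer, run_cond_pos (ea.2 hia), run_cond_pos (eb.2 hib), run_cond_pos (eab.2 hab),
        run_cond_neg (ew.2 hdw)]
    rw [hrun]
    -- Since `w ≤ m`, both distances are finite, so `p a` and `p b` are genuine path chains.
    have hcard : Fintype.card (Fin m) = m := Fintype.card_fin m
    have hZ : dualBdry inc (p a + p b + Pi.single e 1) = 0 := by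
      rw [map_add, map_add, hS.bdry a (by omega), hS.bdry b (by omega),
        dualBdry_single h2 hab hia hib]
      have : ∀ x y z : Fin f → ZMod 2, x + y + (x + z) + (y + z) = 0 := fun x y z => by
        have h : x + y + (x + z) + (y + z) = (x + x) + (y + y) + (z + z) := by abel
        rw [h, add_self_vec x, add_self_vec y, add_self_vec z, add_zero, add_zero]
      exact this _ _ _
    have hwt : wt (p a + p b + Pi.single e 1) ≤ w := by
      have h1 := wt_add_le (p a + p b) (Pi.single e 1)
      have h2 := wt_add_le (p a) (p b)
      have h3 := hS.wt_le a (by omega)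
      have h4 := hS.wt_le b (by omega)
      rw [wt_single] at h1
      omega
    obtain ⟨g'', ν'', hM'', hg', hν', hmem⟩ := run_offer hM he ha hb hp hZ hwt
    refine ⟨(run_reg _ (by decide) _).trans h6, ?_, ?_, g'', ν'', hM'', hg.trans hg',
      fun j hj => (hν' j (hj.trans_le hg)).trans (hν j hj), ?_⟩
    · rw [run_mem _ (by decide)]; exact hd
    · rw [run_mem _ (by decide)]; exact hp
    · rintro x (hx | rfl) h1 h2 h3 h4
      · exact mono hg' hν' (hD x hx h1 h2 h3 h4)
      · exact hmem
  · have hrun : tryOffer.run t' = t' := by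
      by_cases hia : inc a e
      swap
      · rw [tryOffer, run_cond_neg (not_not.1 fun h => hia (ea.1 h))]; rfl
      by_cases hib : inc b e
      swap
      · rw [tryOffer, run_cond_pos (ea.2 hia), run_cond_neg (not_not.1 fun h => hib (eb.1 h))]; rfl
      by_cases hab : a ≠ b
      swap
      · rw [tryOffer, run_cond_pos (ea.2 hia), run_cond_pos (eb.2 hib),
          run_cond_neg (not_not.1 fun h => hab (eab.1 h))]; rfl
      rw [tryOffer, run_cond_pos (ea.2 hia), run_cond_pos (eb.2 hib), run_cond_pos (eab.2 hab),
        run_cond_pos fun h => hc ⟨hab, hia, hib, ew.1 h⟩]; rfl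
    rw [hrun]
    refine ⟨h6, hd, hp, g', ν', hM, hg, hν, ?_⟩
    rintro x (hx | rfl) h1 h2 h3 h4
    · exact hD x hx h1 h2 h3 h4
    · exact absurd ⟨h1, h2, h3, h4⟩ hc

end Greedy

end Cmd

end THS

namespace THS

namespace Cmd

/-! ## Preprocessing -/

section Preprocessing

/-- Write the offsets of the rows into bank 6. -/
def offsets : Cmd :=
  .seq (.assign 5 (.const 0)) (.loop 4 (.add (.add (.reg 1) (.reg 2)) (.const 1))
    (.seq (.store 6 (.reg 4) (.reg 5)) (.assign 5 (.add (.reg 5) (.reg 1)))))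

/-- The indicator of equality. -/
def isEq (a b : Expr) : Expr := .sub (.const 1) (.dist a b)

/-- Nonzero if `a` is a vertex of the triangle in register 10. -/
def inTriangle (a : Expr) : Expr :=
  .add (.add (isEq a (.load 2 (.reg 10))) (isEq a (.load 3 (.reg 10))))
    (isEq a (.load 4 (.reg 10)))

/-- Write the incidence matrix into bank 7. -/
def incidences : Cmd :=
  .loop 10 (.reg 2) (fill 7 (.load 6 (.reg 10)) (.sub (.const 1)
    (.add (.sub (.const 1) (inTriangle (.load 0 (.reg 3))))
      (.sub (.const 1) (inTriangle (.load 1 (.reg 3)))))))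

/-- Insert the coboundaries of the vertices into the echelon form in bank 8. -/
def coboundaries : Cmd :=
  .loop 6 (.reg 0) (.seq (fill 9 (.const 0) (.add (isEq (.reg 6) (.load 0 (.reg 3)))
    (isEq (.reg 6) (.load 1 (.reg 3))))) insert)

/-- The whole algorithm. -/
def main : Cmd := .seq offsets (.seq incidences (.seq coboundaries greedy))

/-- The input of the algorithm: the end points `x e`, `y e` of the edges and the vertices `p a`,
`q a`, `r a` of the faces, and the vector `ζ`. -/
structure Input {n m f : ℕ} (x y : Fin m → Fin n) (p q r : Fin f → Fin n) (ζ : Fin m → ZMod 2)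
    (s : State) : Prop where
  reg0 : s.reg 0 = n
  reg1 : s.reg 1 = m
  reg2 : s.reg 2 = f
  reg_zero : ∀ i, 3 ≤ i → s.reg i = 0
  mem0 : ∀ e : Fin m, s.mem 0 e = x e
  mem1 : ∀ e : Fin m, s.mem 1 e = y e
  mem2 : ∀ a : Fin f, s.mem 2 a = p a
  mem3 : ∀ a : Fin f, s.mem 3 a = q a
  mem4 : ∀ a : Fin f, s.mem 4 a = r a
  mem5 : IsRow (s.mem 5) 0 ζ
  mem_zero : ∀ b i, 6 ≤ b → s.mem b i = 0

variable {n m f : ℕ} {x y : Fin m → Fin n} {p q r : Fin f → Fin n} {ζ : Fin m → ZMod 2}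

/-- Without multiplication, row addresses are found by repeated addition. Matrices have a row for
each edge or each face, so indices up to `m + f` suffice. -/
lemma run_offsets {s : State} (hm : s.reg 1 = m) (hf : s.reg 2 = f) :
    ∀ i ≤ m + f, (offsets.run s).mem 6 i = i * m := by
  have hN : Expr.eval (s.setReg 5 0) (.add (.add (.reg 1) (.reg 2)) (.const 1)) = m + f + 1 := by
    simp [Expr.eval, hm, hf]
  have := (run_loop (s := s.setReg 5 0) (i := 4) (b := .add (.add (.reg 1) (.reg 2)) (.const 1))
    (c := .seq (.store 6 (.reg 4) (.reg 5)) (.assign 5 (.add (.reg 5) (.reg 1))))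
    (fun k s' => s'.reg 5 = k * m ∧ ∀ i < k, s'.mem 6 i = i * m) (by simp) ?_).1
  · rw [hN] at this
    exact fun i hi => this.2 i (by omega)
  · intro k hk s' hF h4 ⟨h5, hI⟩
    have h1 : s'.reg 1 = m := (hF.1 1 (by decide)).trans hm
    refine ⟨by simp [run, Expr.eval, h5, h1, Nat.succ_mul], fun i hi => ?_⟩
    simp only [run, Expr.eval, State.setReg_mem, State.setMem_mem, h4, h5, true_and]
    split_ifs with h
    · rw [h]
    · exact hI i (by omega)

lemma inTriangle_eval (a : Expr) (s : State) : (inTriangle a).eval s = 0 ↔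
    ¬(a.eval s = s.mem 2 (s.reg 10) ∨ a.eval s = s.mem 3 (s.reg 10) ∨
      a.eval s = s.mem 4 (s.reg 10)) := by
  simp only [inTriangle, isEq, Expr.dist_eval, Expr.eval]
  omega

/-- The face `a` contains both end points of the edge `e`. -/
def Incident (x y : Fin m → Fin n) (p q r : Fin f → Fin n) (a : Fin f) (e : Fin m) : Prop :=
  (x e = p a ∨ x e = q a ∨ x e = r a) ∧ (y e = p a ∨ y e = q a ∨ y e = r a)

/-- The coboundary of the vertex `v`. -/
def star (x y : Fin m → Fin n) (v : Fin n) (e : Fin m) : ZMod 2 :=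
  if v = x e ∨ v = y e then 1 else 0

lemma run_incidences {s s₀ : State} (h : Input x y p q r ζ s₀) (hreg : s.reg 1 = m ∧ s.reg 2 = f)
    (hmem : ∀ b < 5, s.mem b = s₀.mem b) (hoff : ∀ i ≤ m + f, s.mem 6 i = i * m) (a : Fin f)
    (e : Fin m) : (incidences.run s).mem 7 (a * m + e) ≠ 0 ↔ Incident x y p q r a e := by
  classical
  have := (run_loop (s := s) (i := 10) (b := .reg 2) (c := fill 7 (.load 6 (.reg 10))
    (.sub (.const 1) (.add (.sub (.const 1) (inTriangle (.load 0 (.reg 3))))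
      (.sub (.const 1) (inTriangle (.load 1 (.reg 3)))))))
    (fun k s' => ∀ a : Fin f, (a : ℕ) < k → IsRow (s'.mem 7) (a * m)
      (fun e : Fin m => if Incident x y p q r a e then 1 else 0)) (by simp) ?_).1
  · rw [Expr.eval, hreg.2] at this
    have h7 := this a a.2 e
    change (incidences.run s).mem 7 (a * m + e) = _ at h7
    rw [h7]
    beta_reduce
    split_ifs with hi <;> simp [hi, ZMod.val_one]
  · intro k hk s' hF h10 hI
    rw [Expr.eval, hreg.2] at hk
    have E := run_fill (s := s') (b := 7) (x := .load 6 (.reg 10)) (e := .sub (.const 1)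
      (.add (.sub (.const 1) (inTriangle (.load 0 (.reg 3))))
        (.sub (.const 1) (inTriangle (.load 1 (.reg 3))))))
      ((hF.1 1 (by decide)).trans hreg.1) (k * m)
      (fun e : Fin m => if Incident x y p q r ⟨k, hk⟩ e then 1 else 0)
      (fun t hF' => by
        simp only [Expr.eval, hF'.1 10 (by decide), h10, hF'.2 6 (by decide), hF.2 6 (by decide)]
        exact hoff k (by omega))
      (fun t hF' j h3 _ => by
        have hb : ∀ b < 5, t.mem b = s₀.mem b := fun b hb => by
          rw [hF'.2 b (by simp [fill, banks]; omega), hF.2 b (by simp [fill, banks]; omega),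
            hmem b hb]
        have ht : t.reg 10 = k := (hF'.1 10 (by decide)).trans h10
        have e0 := inTriangle_eval (.load 0 (.reg 3)) t
        have e1 := inTriangle_eval (.load 1 (.reg 3)) t
        have m2 := h.mem2 ⟨k, hk⟩
        have m3 := h.mem3 ⟨k, hk⟩
        have m4 := h.mem4 ⟨k, hk⟩
        simp only [Expr.eval, h3, ht, hb 0 (by omega), hb 1 (by omega), hb 2 (by omega),
          hb 3 (by omega), hb 4 (by omega), h.mem0, h.mem1, m2, m3, m4, ← Fin.ext_iff] at e0 e1
        rw [Expr.eval, Expr.eval, Expr.eval, Expr.eval]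
        unfold Incident
        by_cases h0 : (x j = p ⟨k, hk⟩ ∨ x j = q ⟨k, hk⟩ ∨ x j = r ⟨k, hk⟩) <;>
          by_cases h1 : (y j = p ⟨k, hk⟩ ∨ y j = q ⟨k, hk⟩ ∨ y j = r ⟨k, hk⟩) <;>
          simp only [h0, h1, not_true, not_false_iff, iff_true, iff_false, and_self, and_false,
            false_and, if_true, if_false, ZMod.val_zero, ZMod.val_one] at e0 e1 ⊢ <;>
          simp only [Expr.eval] <;> omega)
    intro a ha j
    rw [State.setReg_mem]
    by_cases hak : (a : ℕ) = k
    · obtain rfl : a = ⟨k, hk⟩ := Fin.ext hak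
      exact E.1 j
    · rw [E.2 _ (row_disjoint hak j.2)]
      exact hI a (by omega) j

lemma run_coboundaries {s s₀ : State} {inc : Fin f → Fin m → Prop} (h : Input x y p q r ζ s₀)
    (hxy : ∀ e, x e ≠ y e) (hn : s.reg 0 = n) (hE : Env inc s)
    (hmem : s.mem 0 = s₀.mem 0 ∧ s.mem 1 = s₀.mem 1) (h8 : ∀ i, s.mem 8 i = 0) :
    ∃ G : Fin m → Fin m → ZMod 2, IsMat ((coboundaries.run s).mem 8) G ∧ IsEchelon G ∧
      Submodule.span (ZMod 2) (Set.range G) = Submodule.span (ZMod 2) (Set.range (star x y)) := by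
  have := (run_loop (s := s) (i := 6) (b := .reg 0) (c := .seq (fill 9 (.const 0)
      (.add (isEq (.reg 6) (.load 0 (.reg 3))) (isEq (.reg 6) (.load 1 (.reg 3))))) insert)
    (fun k s' => ∃ G : Fin m → Fin m → ZMod 2, IsMat (s'.mem 8) G ∧ IsEchelon G ∧
      Submodule.span (ZMod 2) (Set.range G) =
        Submodule.span (ZMod 2) (star x y '' {v | (v : ℕ) < k})) ⟨0, ?_, ?_, ?_⟩ ?_).1
  · rw [Expr.eval, hn] at this
    have huniv : {v : Fin n | (v : ℕ) < n} = Set.univ := Set.eq_univ_of_forall fun v => v.2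
    rwa [huniv, Set.image_univ] at this
  · intro i j
    simpa using h8 _
  · exact ⟨fun _ _ _ => rfl, fun _ _ => rfl⟩
  · simp only [Nat.not_lt_zero, Set.ofPred_false, Set.image_empty, Submodule.span_empty]
    rw [Submodule.span_eq_bot]
    rintro _ ⟨i, rfl⟩
    rfl
  · rintro k hk s' hF h6 ⟨G, hG, hech, hspan⟩
    rw [Expr.eval, hn] at hk
    have hE' : Env inc s' := hE.frame hF (by decide)
    set s₁ := (fill 9 (.const 0) (.add (isEq (.reg 6) (.load 0 (.reg 3)))
      (isEq (.reg 6) (.load 1 (.reg 3))))).run s' with hs₁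
    have F₁ : Frame _ s' s₁ := frame _ s'
    have e9 : IsRow (s₁.mem 9) 0 (star x y ⟨k, hk⟩) := (run_fill (b := 9) (x := .const 0)
      hE'.edges 0 _ (fun _ _ => rfl) (fun t hF' j h3 _ => by
        have m0 := h.mem0 j
        have m1 := h.mem1 j
        -- Distinct end points keep the sum of the two equality indicators a bit.
        have hne : (x j : ℕ) ≠ y j := fun h => hxy j (Fin.ext h)
        simp only [isEq, Expr.dist_eval, Expr.eval, h3, hF'.1 6 (by decide), h6,
          hF'.2 0 (by decide), hF'.2 1 (by decide), hF.2 0 (by decide), hF.2 1 (by decide),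
          hmem.1, hmem.2, m0, m1, star, Fin.ext_iff]
        split_ifs with hv
        · rw [ZMod.val_one]; omega
        · rw [ZMod.val_zero]; omega)).1
    have hG₁ : IsMat (s₁.mem 8) G := by rw [F₁.2 8 (by decide)]; exact hG
    obtain ⟨G', hG', hech', hspan', -⟩ := run_insert (hE'.frame F₁ (by decide)) e9 hG₁ hech
    refine ⟨G', hG', hech', ?_⟩
    have hset : {v : Fin n | (v : ℕ) < k + 1} = Insert.insert ⟨k, hk⟩ {v : Fin n | (v : ℕ) < k} := by
      ext v
      simp only [Set.mem_ofPred_eq, Set.mem_insert_iff, Fin.ext_iff]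
      omega
    rw [hspan', hspan, hset, Set.image_insert_eq, Submodule.span_insert, sup_comm]

theorem run_main {s : State} (h : Input x y p q r ζ s) (hxy : ∀ e, x e ≠ y e)
    (h2 : TwoFaces (Incident x y p q r)) :
    ∃ g ν, Main (Incident x y p q r) (Submodule.span (ZMod 2) (Set.range (star x y))) ζ (m + 1) g ν
      (main.run s) := by
  set s₁ := offsets.run s with hs₁
  set s₂ := incidences.run s₁ with hs₂
  set s₃ := coboundaries.run s₂ with hs₃
  have F₁ : Frame _ s s₁ := frame _ s
  have F₂ : Frame _ s₁ s₂ := frame _ s₁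
  have F₃ : Frame _ s₂ s₃ := frame _ s₂
  have r1 : s₁.reg 1 = m := (F₁.1 _ (by decide)).trans h.reg1
  have r2 : s₁.reg 2 = f := (F₁.1 _ (by decide)).trans h.reg2
  have hoff := run_offsets h.reg1 h.reg2
  have hE₂ : Env (Incident x y p q r) s₂ := by
    refine ⟨(F₂.1 _ (by decide)).trans r1, (F₂.1 _ (by decide)).trans r2, ?_,
      run_incidences h ⟨r1, r2⟩ (fun b hb => F₁.2 b (by simp [offsets, banks]; omega)) hoff⟩
    rw [F₂.2 _ (by decide)]; exact hoff
  have hech := run_coboundaries h hxy (s := s₂) ?_ hE₂ ?_ ?_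
  · refine run_greedy (ν := 0) h2 (s := s₃)
      ⟨hE₂.frame F₃ (by decide), IsGreedy.zero, ?_, ?_, ?_, by simp, ?_, Or.inl ⟨?_, by simp⟩⟩
    · obtain ⟨G, hG, hech, hspan⟩ := hech
      exact ⟨G, hG, hech, by simp [hspan]⟩
    · rw [F₃.1 _ (by decide), F₂.1 _ (by decide), F₁.1 _ (by decide), h.reg_zero _ (by omega)]
    · rw [F₃.1 _ (by decide), F₂.1 _ (by decide), F₁.1 _ (by decide), h.reg_zero _ (by omega),
        zero_mul]
    · rw [F₃.2 _ (by decide), F₂.2 _ (by decide), F₁.2 _ (by decide)]; exact h.mem5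
    · rw [F₃.1 _ (by decide), F₂.1 _ (by decide), F₁.1 _ (by decide), h.reg_zero _ (by omega)]
  · rw [F₂.1 _ (by decide), F₁.1 _ (by decide), h.reg0]
  · rw [F₂.2 _ (by decide), F₁.2 _ (by decide), F₂.2 _ (by decide), F₁.2 _ (by decide)]
    exact ⟨rfl, rfl⟩
  · intro i
    rw [F₂.2 _ (by decide), F₁.2 _ (by decide), h.mem_zero _ _ (by omega)]

end Preprocessing

end Cmd

end THS

namespace THS

/-! ## Surfaces given by lists of simplices -/

section Listings

variable {n : ℕ} {K : AbstractSimplicialComplex (Fin n)} (L : Listing K)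

namespace Listing

/-- The incidence relation of triangles and edges. -/
def inc (a : Fin L.numTriangles) (e : Fin L.numEdges) : Prop := (L.edge e).1 ⊆ (L.triangle a).1

lemma inc_eq : L.inc = Cmd.Incident (fun e => (L.edgeTuple e).1) (fun e => (L.edgeTuple e).2)
    (fun a => (L.triangleTuple a).1) (fun a => (L.triangleTuple a).2.1)
    (fun a => (L.triangleTuple a).2.2) := by
  funext a e
  simp [inc, Cmd.Incident, L.edgeTuple_spec, L.triangleTuple_spec, Finset.insert_subset_iff]

lemma edgeTuple_ne (e : Fin L.numEdges) : (L.edgeTuple e).1 ≠ (L.edgeTuple e).2 := by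
  intro h
  have h2 := (L.edge e).2.2
  rw [L.edgeTuple_spec, h] at h2
  simp at h2

/-- A cochain as the vector of its values on the edges. -/
noncomputable def vec : Cochain K 1 ≃ₗ[ZMod 2] (Fin L.numEdges → ZMod 2) where
  toFun η i := η (single K (L.edge i))
  map_add' _ _ := rfl
  map_smul' _ _ := rfl
  invFun v :=
    { toFun := fun c => ∑ i, c (L.edge i) * v i
      map_add' := fun c d => by simp [add_mul, Finset.sum_add_distrib]
      map_smul' := fun a c => by simp [Finset.mul_sum, mul_assoc] }
  left_inv η := by
    refine LinearMap.ext fun c => ?_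
    change ∑ i, c (L.edge i) * η (single K (L.edge i)) = η c
    rw [apply_eq_sum η c, ← Equiv.sum_comp L.edge]
  right_inv v := by
    funext i
    change ∑ j, single K (L.edge i) (L.edge j) * v j = v i
    rw [Finset.sum_eq_single i]
    · simp [single]
    · intro j _ hj
      simp [single, hj]
    · simp

lemma vec_apply (η : Cochain K 1) (i : Fin L.numEdges) :
    L.vec η i = η (single K (L.edge i)) := rfl

lemma apply_eq_dotProduct (η : Cochain K 1) (ζ : Chain K 1) :
    η ζ = L.vec η ⬝ᵥ fun i => ζ (L.edge i) := by
  rw [apply_eq_sum, ← Equiv.sum_comp L.edge]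
  exact Finset.sum_congr rfl fun i _ => mul_comm _ _

lemma weight_eq (η : Cochain K 1) : weight K η = wt (L.vec η) := by
  classical
  refine (Finset.card_bij (fun i _ => L.edge i) ?_ ?_ ?_).symm
  · intro i hi
    exact mem_support.2 (zmod_two_eq_one (Finset.mem_filter.1 hi).2)
  · intro i _ j _ h
    exact L.edge.injective h
  · intro e he
    refine ⟨L.edge.symm e, ?_, L.edge.apply_symm_apply e⟩
    rw [Finset.mem_filter, vec_apply, L.edge.apply_symm_apply, mem_support.1 he]
    exact ⟨Finset.mem_univ _, one_ne_zero⟩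

lemma boundary_single {p : ℕ} (σ : Simplex K (p + 1)) (τ : Simplex K p) :
    boundary K p (single K σ) τ = if τ.1 ⊆ σ.1 then 1 else 0 := by
  classical
  simp only [boundary, LinearMap.coe_mk, AddHom.coe_mk]
  rw [Finset.sum_eq_single σ]
  · simp [single]
  · intro σ' _ h
    simp [single, h]
  · simp

/-- The coboundary of `η` at a triangle sums `η` over its edges, which is the boundary in the dual
graph at the corresponding vertex. -/
lemma mem_coZ₁_iff (η : Cochain K 1) : η ∈ coZ₁ K ↔ L.vec η ∈ LinearMap.ker (dualBdry L.inc) := by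
  classical
  have key : ∀ a, η (boundary K 1 (single K (L.triangle a))) = dualBdry L.inc (L.vec η) a := by
    intro a
    rw [apply_eq_sum, ← Equiv.sum_comp L.edge]
    simp only [dualBdry, LinearMap.coe_mk, AddHom.coe_mk]
    refine Finset.sum_congr rfl fun i _ => ?_
    rw [boundary_single, vec_apply]
    unfold inc
    split_ifs <;> simp
  rw [mem_coZ₁, LinearMap.mem_ker]
  constructor
  · intro h
    funext a
    rw [← key]
    exact h _ ⟨_, rfl⟩
  · rintro h _ ⟨c, rfl⟩
    rw [chain_eq_sum_single c, map_sum, map_sum, ← Equiv.sum_comp L.triangle]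
    refine Finset.sum_eq_zero fun a _ => ?_
    rw [map_smul, map_smul, key, h, Pi.zero_apply, smul_zero]

/-- The subspace of the vectors of coboundaries. -/
def cob : Submodule (ZMod 2) (Fin L.numEdges → ZMod 2) :=
  Submodule.span (ZMod 2) (Set.range
    (Cmd.star (fun e => (L.edgeTuple e).1) (fun e => (L.edgeTuple e).2)))

/-- Coordinate functionals span the 0-cochains, and the coboundary of the one at `v` is the
indicator of the edges at `v`. -/
lemma map_coB₁ : (coB₁ K).map L.vec.toLinearMap = L.cob := by
  have key : ∀ (v : Fin n) (hv : ({v} : Finset (Fin n)) ∈ K ∧ ({v} : Finset (Fin n)).card = 0 + 1),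
      L.vec (coboundary K 0 (LinearMap.proj ⟨{v}, hv⟩)) =
        Cmd.star (fun e => (L.edgeTuple e).1) (fun e => (L.edgeTuple e).2) v := by
    intro v hv
    funext i
    change boundary K 0 (single K (L.edge i)) ⟨{v}, hv⟩ = _
    rw [boundary_single]
    simp [Cmd.star, L.edgeTuple_spec]
  apply le_antisymm
  · rintro _ ⟨_, ⟨φ, rfl⟩, rfl⟩
    have hφ : φ = ∑ σ : Simplex K 0, φ (single K σ) • (LinearMap.proj σ : Cochain K 0) := by
      refine LinearMap.ext fun c => ?_
      rw [apply_eq_sum φ c]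
      simp [mul_comm]
    change L.vec (coboundary K 0 φ) ∈ _
    rw [hφ, map_sum, map_sum]
    refine Submodule.sum_mem _ fun σ _ => ?_
    rw [map_smul, map_smul]
    refine Submodule.smul_mem _ _ ?_
    obtain ⟨σ, hσ⟩ := σ
    obtain ⟨v, rfl⟩ := Finset.card_eq_one.1 hσ.2
    rw [key v hσ]
    exact Submodule.subset_span ⟨v, rfl⟩
  · rw [cob, Submodule.span_le]
    rintro _ ⟨v, rfl⟩
    exact ⟨_, ⟨LinearMap.proj ⟨{v}, K.singleton_mem v, Finset.card_singleton v⟩, rfl⟩, key v _⟩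

lemma cls_mem_span_iff {S : Set (Cochain K 1)} {η : Cochain K 1} :
    cls K η ∈ Submodule.span (ZMod 2) (cls K '' S) ↔
      L.vec η ∈ L.cob ⊔ Submodule.span (ZMod 2) (L.vec '' S) := by
  have h : L.cob ⊔ Submodule.span (ZMod 2) (L.vec '' S) =
      (coB₁ K ⊔ Submodule.span (ZMod 2) S).map L.vec.toLinearMap := by
    rw [Submodule.map_sup, Submodule.map_span, map_coB₁]
    rfl
  rw [THS.cls_mem_span_iff, h]
  exact (Submodule.mem_map_equiv (e := L.vec) _).trans (by rw [L.vec.symm_apply_apply]) |>.symm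

/-- The triangles at an edge `{u, w}` correspond to the neighbours of `w` in the link of `u`; the
link is a cycle, so there are two. -/
lemma twoFaces (hK : IsClosedSurface K) : TwoFaces L.inc := by
  classical
  intro e
  obtain ⟨u, hu⟩ : ∃ u, (L.edgeTuple e).1 = u := ⟨_, rfl⟩
  obtain ⟨w, hw⟩ : ∃ w, (L.edgeTuple e).2 = w := ⟨_, rfl⟩
  have he := L.edgeTuple_spec e
  have hne := L.edgeTuple_ne e
  rw [hu, hw] at he hne
  have heK : ({u, w} : Finset (Fin n)) ∈ K := he ▸ (L.edge e).2.1
  obtain ⟨m, hm, ⟨φ⟩⟩ := hK.2 u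
  let W : {a : Fin n // a ≠ u ∧ ({u, a} : Finset (Fin n)) ∈ K} := ⟨w, hne.symm, heK⟩
  have hdeg : (linkGraph K u).degree W = 2 := by
    obtain ⟨m, rfl⟩ := Nat.exists_eq_add_of_le' hm
    rw [← φ.degree_eq, SimpleGraph.cycleGraph_degree_three_le]
  obtain ⟨a, b, hab, hN⟩ := Finset.card_eq_two.1 hdeg
  have hadj : ∀ c, (linkGraph K u).Adj W c ↔ c = a ∨ c = b := by
    intro c
    rw [← SimpleGraph.mem_neighborFinset, hN]
    simp
  have htri : ∀ c, (linkGraph K u).Adj W c → ∃ t, (L.triangle t).1 = {u, w, c.1} := by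
    intro c hc
    have hcard : ({u, w, c.1} : Finset (Fin n)).card = 2 + 1 := by
      rw [Finset.card_eq_three]
      exact ⟨u, w, c.1, hne, c.2.1.symm, fun h => hc.1 (Subtype.ext h), rfl⟩
    exact ⟨L.triangle.symm ⟨_, hc.2, hcard⟩, by rw [L.triangle.apply_symm_apply]⟩
  obtain ⟨ta, hta⟩ := htri a ((hadj a).2 (Or.inl rfl))
  obtain ⟨tb, htb⟩ := htri b ((hadj b).2 (Or.inr rfl))
  have hWa : w ≠ a.1 := fun h => ((hadj a).2 (Or.inl rfl)).1 (Subtype.ext h)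
  have hWb : w ≠ b.1 := fun h => ((hadj b).2 (Or.inr rfl)).1 (Subtype.ext h)
  refine ⟨ta, tb, ?_, fun t => ⟨fun ht => ?_, ?_⟩⟩
  · rintro rfl
    have : a.1 ∈ ({u, w, b.1} : Finset (Fin n)) := by rw [← htb, hta]; simp
    simp only [Finset.mem_insert, Finset.mem_singleton] at this
    rcases this with h | h | h
    · exact a.2.1 h
    · exact hWa h.symm
    · exact hab (Subtype.ext h)
  · rw [inc, he] at ht
    have hc1 : ((L.triangle t).1 \ {u, w}).card = 1 := by
      rw [Finset.card_sdiff_of_subset ht, (L.triangle t).2.2, Finset.card_pair hne]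
    obtain ⟨c, hc⟩ := Finset.card_eq_one.1 hc1
    have hcm : c ∈ (L.triangle t).1 \ {u, w} := hc ▸ Finset.mem_singleton_self c
    have ht3 : (L.triangle t).1 = {u, w, c} := by
      rw [← Finset.sdiff_union_of_subset ht, hc]
      ext z
      simp only [Finset.mem_union, Finset.mem_insert, Finset.mem_singleton]
      tauto
    simp only [Finset.mem_sdiff, Finset.mem_insert, Finset.mem_singleton, not_or] at hcm
    have hcK : ({u, c} : Finset (Fin n)) ∈ K := by
      refine (K.isRelLowerSet_faces (L.triangle t).2.1).2 ?_ (Finset.insert_nonempty _ _)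
      rw [ht3]
      intro z
      simp only [Finset.mem_insert, Finset.mem_singleton]
      tauto
    have hA : (linkGraph K u).Adj W ⟨c, hcm.2.1, hcK⟩ :=
      ⟨fun h => hcm.2.2 (congrArg Subtype.val h).symm, by
        change ({u, w, c} : Finset (Fin n)) ∈ K
        rw [← ht3]; exact (L.triangle t).2.1⟩
    rcases (hadj _).1 hA with h | h
    · left
      apply L.triangle.injective
      apply Subtype.ext
      rw [ht3, hta, ← h]
    · right
      apply L.triangle.injective
      apply Subtype.ext
      rw [ht3, htb, ← h]
  · rintro (rfl | rfl)
    · rw [inc, he, hta]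
      intro z; simp only [Finset.mem_insert, Finset.mem_singleton]; tauto
    · rw [inc, he, htb]
      intro z; simp only [Finset.mem_insert, Finset.mem_singleton]; tauto

lemma isInput (ζ : Chain K 1) : Cmd.Input (fun e => (L.edgeTuple e).1)
    (fun e => (L.edgeTuple e).2) (fun a => (L.triangleTuple a).1)
    (fun a => (L.triangleTuple a).2.1) (fun a => (L.triangleTuple a).2.2)
    (fun i => ζ (L.edge i)) (L.input ζ) where
  reg0 := rfl
  reg1 := rfl
  reg2 := rfl
  reg_zero
    | 0, h => by omega
    | 1, h => by omega
    | 2, h => by omega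
    | _ + 3, _ => rfl
  mem0 e := by simp [input, toArray]
  mem1 e := by simp [input, toArray]
  mem2 a := by simp [input, toArray]
  mem3 a := by simp [input, toArray]
  mem4 a := by simp [input, toArray]
  mem5 e := by simp [input, toArray]
  mem_zero
    | 0, _, h => by omega
    | 1, _, h => by omega
    | 2, _, h => by omega
    | 3, _, h => by omega
    | 4, _, h => by omega
    | 5, _, h => by omega
    | _ + 6, _, _ => rfl

/-- The final state of the greedy algorithm holds a result of the three-step algorithm. -/
theorem exists_result {ζ : Chain K 1} (hζ : ζ ∈ Z₁ K) (hζB : ζ ∉ B₁ K) {g : ℕ}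
    {ν : ℕ → Fin L.numEdges → ZMod 2} {s : State}
    (h : Cmd.Main L.inc L.cob (fun i => ζ (L.edge i)) (L.numEdges + 1) g ν s) :
    ∃ (ν' : Fin g → Cochain K 1) (k : Fin g), IsAlgorithmResult K ζ ν' k ∧
      (∀ j, L.vec (ν' j) = ν j) ∧ s.reg 15 = k ∧ IsRow (s.mem 1) 0 (ν k) := by
  let ν' : Fin g → Cochain K 1 := fun j => L.vec.symm (ν j)
  have hν' : ∀ j, L.vec (ν' j) = ν j := fun j => L.vec.apply_symm_apply _
  have hwt : ∀ j, weight K (ν' j) = wt (ν j) := fun j => by rw [L.weight_eq, hν']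
  have hmem : ∀ j, ν' j ∈ coZ₁ K := fun j => by
    rw [L.mem_coZ₁_iff, hν']
    exact h.isGreedy.mem j j.2
  have himage : ∀ S : Set (Fin g), (fun j => cls K (ν' j)) '' S = cls K '' (ν' '' S) := fun S => by
    rw [Set.image_image]
  have hspan : ∀ η ∈ coZ₁ K, cls K η ∈ Submodule.span (ZMod 2)
      ((fun j => cls K (ν' j)) '' {j | weight K (ν' j) ≤ weight K η}) := by
    intro η hη
    rw [himage, L.cls_mem_span_iff]
    refine sup_span_mono ?_ (h.isGreedy.spans _ ((L.mem_coZ₁_iff η).1 hη) ?_)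
    · rintro _ ⟨j, ⟨hj, hw⟩, rfl⟩
      refine ⟨ν' ⟨j, hj⟩, ⟨⟨j, hj⟩, ?_, rfl⟩, hν' _⟩
      rwa [Set.mem_ofPred_eq, hwt, L.weight_eq]
    -- The final threshold is the number of edges plus 1, which exceeds every weight.
    · have := wt_le_card (L.vec η)
      rw [Fintype.card_fin] at this
      omega
  have hbasis : IsCohomologyBasis K ν' := by
    refine ⟨hmem, linearIndependent_of_notMem_span_lt fun i hi => ?_, le_antisymm ?_ ?_⟩
    · rw [himage, L.cls_mem_span_iff, hν'] at hi
      refine h.isGreedy.indep i i.2 (sup_span_mono ?_ hi)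
      rintro _ ⟨_, ⟨j, hj, rfl⟩, rfl⟩
      exact ⟨j, hj, (hν' j).symm⟩
    · rw [Submodule.span_le]
      rintro _ ⟨j, rfl⟩
      exact cls_mem_coH₁ (hmem j)
    · rintro _ ⟨η, hη, rfl⟩
      exact Submodule.span_mono (Set.image_subset_range _ _) (hspan η hη)
  have hval : ∀ j, ν' j ζ = ν j ⬝ᵥ fun i => ζ (L.edge i) := fun j => by
    rw [L.apply_eq_dotProduct, hν']
  rcases h.found with ⟨-, h0⟩ | ⟨-, h15, h1, hlt, hrow⟩
  -- If all basis cocycles vanished at `ζ`, so would every cocycle, although `ζ` is not a boundary.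
  · exfalso
    obtain ⟨η, hη, hker⟩ := Submodule.exists_le_ker_of_notMem hζB
    obtain ⟨c, -, hsum⟩ := hbasis.exists_coeff (mem_coZ₁.2 hker) hζ
    refine hη (hsum.trans (Finset.sum_eq_zero fun j _ => ?_))
    rw [hval, h0 j j.2, mul_zero]
  · refine ⟨ν', ⟨s.reg 15, h15⟩, ⟨hbasis.isMin hspan, fun i j hij => ?_, ?_, fun j hj => ?_⟩, hν',
      rfl, hrow⟩
    · change weight K (ν' i) ≤ weight K (ν' j)
      rw [hwt, hwt]
      exact h.isGreedy.sorted i j hij j.2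
    · rw [hval]; exact h1
    · rw [hwt, hwt]
      -- In a sorted list the first member with value 1 at `ζ` is a lightest one.
      refine h.isGreedy.sorted _ _ ?_ j.2
      by_contra! hlt'
      rw [hval, hlt j hlt'] at hj
      exact zero_ne_one hj

end Listing

/-! ### The program and the theorem -/

/-- The program that carries out the algorithm. -/
def program : Prog :=
  -- The results move to the output registers only at the end, because registers 0 and 1 hold loop
  -- bounds until then.
  .comp Cmd.main.compile (.comp (.assign 0 (.reg 12)) (.assign 1 (.reg 15)))

open Polynomial in
/-- The bound on the running time of the program. -/
noncomputable def timeBound : Polynomial ℕ := Cmd.main.time + C 4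

theorem exec_program (hK : IsClosedSurface K) {ζ : Chain K 1} (hζ : ζ ∈ Z₁ K) (hζB : ζ ∉ B₁ K) :
    ∃ (t : ℕ) (s : State), Exec program (L.input ζ) t s ∧ t ≤ timeBound.eval L.size ∧
      ∃ (g : ℕ) (ν : Fin g → Cochain K 1) (k : Fin g),
        L.IsOutput ν k s ∧ IsAlgorithmResult K ζ ν k := by
  obtain ⟨t, ht, hexec⟩ := Cmd.exec_compile (c := Cmd.main) (by decide) (L.input ζ)
  have h2 := L.twoFaces hK
  rw [L.inc_eq] at h2
  obtain ⟨g, ν, hM⟩ := Cmd.run_main (L.isInput ζ) L.edgeTuple_ne h2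
  rw [← L.inc_eq] at hM
  obtain ⟨ν', k, hres, hν, hk, hrow⟩ := L.exists_result hζ hζB hM
  refine ⟨_, _, .comp hexec (.comp (.assign _ 0 (.reg 12)) (.assign _ 1 (.reg 15))), ?_, g, ν', k,
    ⟨?_, ?_, fun j i => ?_, fun i => ?_⟩, hres⟩
  · rw [timeBound, Polynomial.eval_add, Polynomial.eval_C]
    exact Nat.add_le_add ht le_rfl
  · simp [Expr.eval, hM.count]
  · simp [Expr.eval, hk]
  · simp only [State.setReg_mem]
    rw [hM.out j j.2 i, ← hν]
    rfl
  · simp only [State.setReg_mem]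
    have := hrow i
    rw [zero_add, ← hν] at this
    exact this

end Listings

end THS

theorem mainTheorem1 :
    -- Correctness: the algorithm has a result on every input, and every result is optimal.
    (∀ (V : Type*) [Finite V] [DecidableEq V] (K : AbstractSimplicialComplex V),
      THS.IsClosedSurface K → ∀ ζ : THS.Chain K 1, ζ ∈ THS.Z₁ K → ζ ∉ THS.B₁ K →
        (∃ (g : ℕ) (ν : Fin g → THS.Cochain K 1) (k : Fin g), THS.IsAlgorithmResult K ζ ν k) ∧
        ∀ (g : ℕ) (ν : Fin g → THS.Cochain K 1) (k : Fin g), THS.IsAlgorithmResult K ζ ν k →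
          THS.IsOptimalHittingSet K ζ (THS.support K (ν k))) ∧
    -- Running time: one program carries the algorithm out in polynomially many steps.
    ∃ (P : THS.Prog) (p : Polynomial ℕ),
      ∀ (n : ℕ) (K : AbstractSimplicialComplex (Fin n)),
        THS.IsClosedSurface K → ∀ ζ : THS.Chain K 1, ζ ∈ THS.Z₁ K → ζ ∉ THS.B₁ K →
          ∀ L : THS.Listing K, ∃ (t : ℕ) (s : THS.State),
            THS.Exec P (L.input ζ) t s ∧ t ≤ p.eval L.size ∧
            ∃ (g : ℕ) (ν : Fin g → THS.Cochain K 1) (k : Fin g),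
              L.IsOutput ν k s ∧ THS.IsAlgorithmResult K ζ ν k ∧
              THS.IsOptimalHittingSet K ζ (THS.support K (ν k)) := by
  refine ⟨fun V _ _ K _ ζ hζ hζB => ⟨THS.exists_isAlgorithmResult hζ hζB,
    fun g ν k h => h.isOptimalHittingSet hζ⟩, THS.program, THS.timeBound,
    fun n K hK ζ hζ hζB L => ?_⟩
  obtain ⟨t, s, hexec, ht, g, ν, k, hout, hres⟩ := THS.exec_program L hK hζ hζB
  exact ⟨t, s, hexec, ht, g, ν, k, hout, hres, hres.isOptimalHittingSet hζ⟩
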